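/- Setting. A family of time-dependent conductances on a graph assigns to each time $t$ a symmetric function $\mu^{(t)}(x,y)\ge 0$, positive exactly when $\{x,y\}$ is an edge (loops $\{x,x\}$ may be edges), and uniformly elliptic: for some $c_1\in(0,1]$, $c_1\le\mu^{(t)}(x,y)\le c_1^{-1}$ for all edges and all $t$. Put $\mu^{(t)}(x)=\sum_y\mu^{(t)}(x,y)$ and $P^{(t)}(x,y)=\mu^{(t)}(x,y)/\mu^{(t)}(x)$. The discrete time random walk $\{X_t\}_{t\in\mathbb N}$ is the Markov chain with transition probability $P^{(t)}(x,y)$ from time $t$ to time $t+1$; it is $\gamma$-lazy if $P^{(t)}(x,x)\ge\gamma$ for all $x$ and $t$. The constant speed random walk (CSRW) $\{Y_t\}_{t\in\mathbb R_+}$ is the right-continuous step process whose successive holding times are i.i.d. $\exp(1)$, each independent of the past of the walk, and which, at a jump time $T$ with $Y_{T^-}=x$, jumps to $y$ with conditional probability $P^{(T)}(x,y)$ given the past and $T$. A walk on $\mathbb Z$ is ballistic if, almost surely, its position divided by $t$ converges as $t\to\infty$ to a deterministic $v\neq0$; it is transient if almost surely it returns to its starting point only finitely often (and, in continuous time, is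 not at its starting point after some finite time). The heat kernel of a walk $Y$ started at $x$ is $p(0,x;t,y)=\mathbb P(Y_t=y)/\mu^{(t)}(y)$. Write $d(x,y)=|x-y|$ and let $\nu(\mathbb B(x,r))$ be the number of $y\in\mathbb Z$ with $d(x,y)\le r$. For a starting point $x$, the Gaussian on-diagonal lower bound is: there is $c_6>0$ such that $$p(0,x;t,x)\ \ge\ \frac{c_6}{\nu(\mathbb B(x,t^{1/2}))}\qquad\text{for all times } t>0.$$ The Gaussian off-diagonal upper bound is: there are $C_4,C_5>0$ such that for all $y\ne x$ and all times $t>0$, $$p(0,x;t,y)\le \frac{C_4}{\nu(\mathbb B(x,t^{1/2}))}\begin{cases}\exp\big(-C_5\,d(x,y)\,(1\vee\log\frac{d(x,y)}{t})\big), & t\le d(x,y),\\ \exp\big(-C_5\,d(x,y)^2/t\big), & t\ge d(x,y).\end{cases}$$ Proposition. (i) For any $\gamma<1$ and $\varepsilon>0$ there exist uniformly elliptic time-dependent conductances $\{\mu^{(t)}(x,x\pm1),\mu^{(t)}(x,x):x\in\mathbb Z\}$, $t\in\mathbb N$, on $\mathbb Z$ (with nearest-neighbour edges and loops) such that $$1-\varepsilon\le\mu^{(t)}(x,x\pm1)\le1+\varepsilon\qquad\forall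 x\in\mathbb Z,\ t\in\mathbb N,$$ and such that, from every starting point, the corresponding discrete time random walk exists, is $\gamma$-lazy, ballistic and transient. (ii) For any $\varepsilon,c>0$ there exist uniformly elliptic time-dependent conductances $\{\mu^{(t)}(x,x\pm1):x\in\mathbb Z\}$, $t\in\mathbb R_+$, on $\mathbb Z$ (with nearest-neighbour edges and no loops) with $$1-\varepsilon\le\mu^{(t)}(x,x\pm1)\le1+\varepsilon\qquad\forall x\in\mathbb Z,\ t\in\mathbb R_+,$$ and times $0=t_0<t_1<t_2<\cdots\to\infty$ with $t_n/n\to1/c$, such that the conductances are constant in time on each $[t_n,t_{n+1})$ and do change at each $t_n$, $n\ge1$, and such that, from every starting point, the corresponding CSRW exists, is ballistic and transient. In particular, for the same conductances, both walks, from every starting point, violate the Gaussian on-diagonal lower bound as well as the Gaussian off-diagonal upper bound on $\mathbb Z$. -/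

import Mathlib

open MeasureTheory ProbabilityTheory Filter Topology
open scoped NNReal ENNReal

/-- `μ` is a family, indexed by the time `t : 𝕋`, of uniformly elliptic conductances on the graph with
vertex set `V` and edge relation `E` (loops allowed): each `μ t` is symmetric and nonnegative,
positive exactly on the edges, and `c₁ ≤ μ t x y ≤ c₁⁻¹` on all edges, uniformly in time. -/
structure IsTimeDepConductance {𝕋 V : Type*} (E : V → V → Prop) (μ : 𝕋 → V → V → ℝ) : Prop where
  symm : ∀ t x y, μ t x y = μ t y x
  nonneg : ∀ t x y, 0 ≤ μ t x y
  pos_iff : ∀ t x y, 0 < μ t x y ↔ E x y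
  elliptic : ∃ c₁ : ℝ, 0 < c₁ ∧ c₁ ≤ 1 ∧ ∀ t x y, E x y → c₁ ≤ μ t x y ∧ μ t x y ≤ c₁⁻¹

/-- The vertex weight `μ^{(t)}(x) = ∑_y μ^{(t)}(x, y)`. -/
noncomputable def vertexWeight {𝕋 V : Type*} (μ : 𝕋 → V → V → ℝ) (t : 𝕋) (x : V) : ℝ :=
  ∑' y, μ t x y

/-- The one-step transition probability `P^{(t)}(x, y) = μ^{(t)}(x, y) / μ^{(t)}(x)`. -/
noncomputable def stepProb {𝕋 V : Type*} (μ : 𝕋 → V → V → ℝ) (t : 𝕋) (x y : V) : ℝ :=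
  μ t x y / vertexWeight μ t x

/-- `γ`-laziness: `P^{(t)}(x, x) ≥ γ` for all vertices and times. -/
def IsLazy {𝕋 V : Type*} (γ : ℝ) (μ : 𝕋 → V → V → ℝ) : Prop :=
  ∀ t x, γ ≤ stepProb μ t x x

/-- The graph `ℤ` with nearest-neighbour edges and a loop at every vertex. -/
def intLoopEdge (x y : ℤ) : Prop := |x - y| ≤ 1

/-- The graph `ℤ` with nearest-neighbour edges only. -/
def intEdge (x y : ℤ) : Prop := |x - y| = 1

/-- `μ` is piecewise constant in time, and `0 = τ 0 < τ 1 < τ 2 < ⋯ → ∞` are exactly the times at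
which it changes (`τ 0 = 0` being the initial time). -/
structure ChangesExactlyAt {V : Type*} (μ : ℝ≥0 → V → V → ℝ) (τ : ℕ → ℝ≥0) : Prop where
  zero : τ 0 = 0
  strictMono : StrictMono τ
  unbounded : Tendsto τ atTop atTop
  const : ∀ n t, τ n ≤ t → t < τ (n + 1) → μ t = μ (τ n)
  changes : ∀ n, μ (τ (n + 1)) ≠ μ (τ n)

/-- `X` is a discrete time random walk among the conductances `μ`: a Markov chain with
transition probability `P^{(n)}(x, y)` from time `n` to time `n + 1`. -/
structure IsDiscreteWalk {Ω V : Type*} [MeasurableSpace Ω] [MeasurableSpace V]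
    (μ : ℕ → V → V → ℝ) (P : Measure Ω) (X : ℕ → Ω → V) : Prop where
  measurable : ∀ n, Measurable (X n)
  markov : ∀ (n : ℕ) (x : ℕ → V),
    P {ω | ∀ i ≤ n + 1, X i ω = x i} =
      P {ω | ∀ i ≤ n, X i ω = x i} * ENNReal.ofReal (stepProb μ n (x n) (x (n + 1)))

/-- The `n`-th jump time `T_n = ∑_{k < n} H_k`, where `H_k` are the holding times (`T_0 = 0`). -/
def jumpTime {Ω : Type*} (H : ℕ → Ω → ℝ≥0) (n : ℕ) (ω : Ω) : ℝ≥0 :=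
  ∑ k ∈ Finset.range n, H k ω

/-- `Y` is a constant speed random walk among the conductances `μ`, with successive positions
`J 0, J 1, …` and holding times `H 0, H 1, …`. -/
structure IsCSRWWith {Ω V : Type*} [MeasurableSpace Ω] [MeasurableSpace V]
    (μ : ℝ≥0 → V → V → ℝ) (P : Measure Ω) (Y : ℝ≥0 → Ω → V)
    (J : ℕ → Ω → V) (H : ℕ → Ω → ℝ≥0) : Prop where
  measurable : ∀ t, Measurable (Y t)
  measurable_pos : ∀ n, Measurable (J n)
  measurable_hold : ∀ n, Measurable (H n)
  /-- Every holding time is exponential with rate one … -/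
  hold_law : ∀ n, P.map (fun ω => (H n ω : ℝ)) = expMeasure 1
  /-- … and independent of the walk up to the beginning of that holding time. -/
  hold_indep : ∀ n : ℕ, IndepFun (H n)
    (fun ω => ((fun i : Fin (n + 1) => J i ω), (fun i : Fin n => H i ω))) P
  /-- Given the past and the jump time `T = T_{n+1}`, the walk jumps from its current position
  `J n` to `y` with conditional probability `P^{(T)}(J n, y)`. -/
  jump : ∀ (n : ℕ) (y : V) (B : Set ((Fin (n + 1) → V) × (Fin (n + 1) → ℝ≥0))),
    MeasurableSet B →
    P {ω | ((fun i : Fin (n + 1) => J i ω), (fun i : Fin (n + 1) => H i ω)) ∈ B ∧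
        J (n + 1) ω = y} =
      ∫⁻ ω in {ω | ((fun i : Fin (n + 1) => J i ω), (fun i : Fin (n + 1) => H i ω)) ∈ B},
        ENNReal.ofReal (stepProb μ (jumpTime H (n + 1) ω) (J n ω) y) ∂P
  /-- The right-continuous step path: `Y t = J n` for `T_n ≤ t < T_{n+1}`. -/
  path : ∀ᵐ ω ∂P, ∀ n t, jumpTime H n ω ≤ t → t < jumpTime H (n + 1) ω → Y t ω = J n ω

/-- `Y` is a constant speed random walk (CSRW) among the conductances `μ`. -/
def IsCSRW {Ω V : Type*} [MeasurableSpace Ω] [MeasurableSpace V]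
    (μ : ℝ≥0 → V → V → ℝ) (P : Measure Ω) (Y : ℝ≥0 → Ω → V) : Prop :=
  ∃ (J : ℕ → Ω → V) (H : ℕ → Ω → ℝ≥0), IsCSRWWith μ P Y J H

/-- Ballistic: almost surely `X_t / t` converges to a deterministic nonzero velocity. The time
set `𝕋` is `ℕ` or `ℝ≥0`, and `time` is the inclusion into `ℝ`. -/
def IsBallistic {Ω 𝕋 : Type*} [MeasurableSpace Ω] [Preorder 𝕋] (time : 𝕋 → ℝ)
    (P : Measure Ω) (X : 𝕋 → Ω → ℤ) : Prop :=
  ∃ v : ℝ, v ≠ 0 ∧ ∀ᵐ ω ∂P, Tendsto (fun t => (X t ω : ℝ) / time t) atTop (𝓝 v)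

/-- Discrete time transience: almost surely only finitely many visits to the starting point. -/
def IsTransientDiscrete {Ω V : Type*} [MeasurableSpace Ω] (P : Measure Ω) (X : ℕ → Ω → V) : Prop :=
  ∀ᵐ ω ∂P, {n | X n ω = X 0 ω}.Finite

/-- Continuous time transience: almost surely the walk comes back to its starting point only
finitely often (`t` is a time of return if the path is at its starting point at `t`
and away from it during some interval `[s, t)`), and it is not there after some finite time. -/
def IsTransientCont {Ω V : Type*} [MeasurableSpace Ω] (P : Measure Ω) (Y : ℝ≥0 → Ω → V) : Prop :=
  ∀ᵐ ω ∂P,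
    {t | Y t ω = Y 0 ω ∧ ∃ s < t, ∀ r, s ≤ r → r < t → Y r ω ≠ Y 0 ω}.Finite ∧
    BddAbove {t | Y t ω = Y 0 ω}

/-- The heat kernel `p(0, x; t, y) = P(Y_t = y) / μ^{(t)}(y)` of a walk `Y` started at `x`. -/
noncomputable def heatKernel {Ω 𝕋 V : Type*} [MeasurableSpace Ω] (μ : 𝕋 → V → V → ℝ)
    (P : Measure Ω) (Y : 𝕋 → Ω → V) (t : 𝕋) (y : V) : ℝ :=
  P.real {ω | Y t ω = y} / vertexWeight μ t y

/-- `ν(B(x, r))`: the number of points of `ℤ` at (graph) distance at most `r` from `x`. -/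
noncomputable def ballVol (x : ℤ) (r : ℝ) : ℝ := (Metric.closedBall x r).ncard

/-- The Gaussian upper bound function on `ℤ`, with constants `C₄, C₅`; `dist x y = |x - y|` is
the graph distance. -/
noncomputable def gaussUpper (C₄ C₅ t : ℝ) (x y : ℤ) : ℝ :=
  if t ≤ dist x y then
    C₄ / ballVol x (√t) * Real.exp (-C₅ * dist x y * max 1 (Real.log (dist x y / t)))
  else
    C₄ / ballVol x (√t) * Real.exp (-C₅ * (dist x y ^ 2 / t))

/-- The on-diagonal Gaussian lower bound at `x` for the heat kernel `p t y = p(0, x; t, y)`. -/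
def OnDiagLowerBound {𝕋 : Type*} (time : 𝕋 → ℝ) (p : 𝕋 → ℤ → ℝ) (x : ℤ) : Prop :=
  ∃ c₆ : ℝ, 0 < c₆ ∧ ∀ t, 0 < time t → c₆ / ballVol x (√(time t)) ≤ p t x

/-- The off-diagonal Gaussian upper bound from `x` for the heat kernel
`p t y = p(0, x; t, y)`. -/
def OffDiagUpperBound {𝕋 : Type*} (time : 𝕋 → ℝ) (p : 𝕋 → ℤ → ℝ) (x : ℤ) : Prop :=
  ∃ C₄ C₅ : ℝ, 0 < C₄ ∧ 0 < C₅ ∧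
    ∀ t y, 0 < time t → y ≠ x → p t y ≤ gaussUpper C₄ C₅ (time t) x y

/-!
The conductances are periodic patterns of edge weights `1 + e` and `1` that move through `ℤ`. The
walk modulo the period is then a finite Markov chain, driven in continuous time by a periodic
rotation, and its position is an additive functional of that chain. In a pattern at rest the
stationary mean drift vanishes by reversibility; the motion of the pattern has to break this.

In discrete time the pattern has period two and is swapped at each step (`altEdge`). The walk feels a
drift to the right when `x + n` is even and to the left when it is odd, and it changes between the two
classes exactly when it uses a loop. The loops have weight `L` in the first class and `2 L` in the
second (`altLoop`), so the numbers of non-loop steps made in the two classes differ, and the drifts do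
not cancel. In continuous time there are no loops, and period two gives speed zero, since the parity
of a Poisson process equidistributes. Instead one heavy edge out of three is moved one step to the
right at the multiples of `s = 1 / c` (`rotEdge`). At each rotation the law of the walk relative to the
pattern is thrown out of the equilibrium of the new pattern, and the displacement gained during the
relaxation has positive mean (`rotShift_pos`).

The speed `v` is identified by solving the Poisson equation explicitly: there is a bounded corrector
`g` such that `x - v t + g(t, x)` is space-time harmonic (`altHarmonic_harmonic`; in continuous time
`rotHarmonic`, with `continuous_rotHarmonic` and `hasDerivWithinAt_rotHarmonic`). Such a function is a
martingale along the discrete walk, and along the pairs (jump time, position) of the CSRW, where the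
martingale property is the resolvent identity `integral_expMeasure_of_hasDeriv_right` for the
exponential holding time. The increments have uniform exponential moments, so linear deviations have
exponentially small probability (`expSmall_of_exp_step`, `IsDiscreteWalk.expSmall_harmonic`,
`IsCSRWWith.expSmall_harmonic`). All that is used about the walks is the Markov property in integrated
form (`IsDiscreteWalk.lintegral_succ`, `IsCSRWWith.lintegral_succ`).

Everything else follows (`discrete_conclusion`, `csrw_conclusion`). The Borel–Cantelli lemma yields the
law of large numbers, hence ballisticity and transience. The probability of being at the starting
point at time `n` decays exponentially, which contradicts the on-diagonal lower bound of order
`n ^ (-1/2)` (`not_onDiagLowerBound`). At time `n` the walk is, with high probability, at one of `O(n)`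
sites at distance of order `n`, so at one of them the heat kernel is at least of order `1 / n`, where
the off-diagonal upper bound is exponentially small (`not_offDiagUpperBound`).

Both walks are constructed from a sequence of independent exponential and uniform variables
(`isDiscreteWalk_discreteWalk`, `isCSRWWith_noise`).
-/

/-! ### Nearest-neighbour conductances -/

/-- The nearest-neighbour conductances on `ℤ` in which the edge `{x, x + 1}` has weight `w t x` and
the loop at `x` has weight `ℓ t x`, at time `t`. -/
def nnCond {𝕋 : Type*} (w ℓ : 𝕋 → ℤ → ℝ) (t : 𝕋) (x y : ℤ) : ℝ :=
  if y = x + 1 then w t x else if x = y + 1 then w t y else if x = y then ℓ t x else 0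

section nnCond

variable {𝕋 : Type*} (w ℓ : 𝕋 → ℤ → ℝ) (t : 𝕋) (x : ℤ)

lemma nnCond_right : nnCond w ℓ t x (x + 1) = w t x := by simp [nnCond]

lemma nnCond_left : nnCond w ℓ t x (x - 1) = w t (x - 1) := by
  have h : x - 1 ≠ x + 1 := by omega
  simp [nnCond, h]

lemma nnCond_self : nnCond w ℓ t x x = ℓ t x := by simp [nnCond]

lemma nnCond_eq_zero {y : ℤ} (h1 : y ≠ x + 1) (h2 : y ≠ x - 1) (h3 : y ≠ x) :
    nnCond w ℓ t x y = 0 := by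
  have h2' : x ≠ y + 1 := by omega
  simp [nnCond, h1, h2', h3.symm]

lemma nnCond_symm (y : ℤ) : nnCond w ℓ t x y = nnCond w ℓ t y x := by
  unfold nnCond
  split_ifs <;> first | rfl | omega | skip
  subst_vars; rfl

lemma vertexWeight_nnCond :
    vertexWeight (nnCond w ℓ) t x = w t x + w t (x - 1) + ℓ t x := by
  unfold vertexWeight
  rw [tsum_eq_sum (s := {x + 1, x - 1, x})]
  · rw [Finset.sum_insert, Finset.sum_insert, Finset.sum_singleton, nnCond_right, nnCond_left,
      nnCond_self, add_assoc]
    · simp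
    · simp; omega
  · intro y hy
    simp only [Finset.mem_insert, Finset.mem_singleton, not_or] at hy
    exact nnCond_eq_zero w ℓ t x hy.1 hy.2.1 hy.2.2

lemma stepProb_nnCond_eq_zero {y : ℤ} (h1 : y ≠ x + 1) (h2 : y ≠ x - 1) (h3 : y ≠ x) :
    stepProb (nnCond w ℓ) t x y = 0 := by
  simp [stepProb, nnCond_eq_zero w ℓ t x h1 h2 h3]

lemma stepProb_nnCond_right :
    stepProb (nnCond w ℓ) t x (x + 1) = w t x / (w t x + w t (x - 1) + ℓ t x) := by
  rw [stepProb, vertexWeight_nnCond, nnCond_right]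

lemma stepProb_nnCond_left :
    stepProb (nnCond w ℓ) t x (x - 1) = w t (x - 1) / (w t x + w t (x - 1) + ℓ t x) := by
  rw [stepProb, vertexWeight_nnCond, nnCond_left]

lemma stepProb_nnCond_self :
    stepProb (nnCond w ℓ) t x x = ℓ t x / (w t x + w t (x - 1) + ℓ t x) := by
  rw [stepProb, vertexWeight_nnCond, nnCond_self]

lemma tsum_stepProb_nnCond_mul (G : ℤ → ℝ≥0∞) :
    ∑' y, ENNReal.ofReal (stepProb (nnCond w ℓ) t x y) * G y =
      ENNReal.ofReal (stepProb (nnCond w ℓ) t x (x + 1)) * G (x + 1) +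
        ENNReal.ofReal (stepProb (nnCond w ℓ) t x (x - 1)) * G (x - 1) +
        ENNReal.ofReal (stepProb (nnCond w ℓ) t x x) * G x := by
  rw [tsum_eq_sum (s := {x + 1, x - 1, x})]
  · rw [Finset.sum_insert, Finset.sum_insert, Finset.sum_singleton, add_assoc]
    · simp
    · simp; omega
  · intro y hy
    simp only [Finset.mem_insert, Finset.mem_singleton, not_or] at hy
    simp [stepProb_nnCond_eq_zero w ℓ t x hy.1 hy.2.1 hy.2.2]

variable {w ℓ}

lemma stepProb_nnCond_nonneg (hw : ∀ t x, 0 < w t x) (hℓ : ∀ t x, 0 ≤ ℓ t x) (y : ℤ) :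
    0 ≤ stepProb (nnCond w ℓ) t x y := by
  rw [stepProb, vertexWeight_nnCond]
  refine div_nonneg ?_ (by linarith [hw t x, hw t (x - 1), hℓ t x])
  unfold nnCond
  split_ifs
  exacts [(hw _ _).le, (hw _ _).le, hℓ _ _, le_rfl]

lemma stepProb_nnCond_add (hw : ∀ t x, 0 < w t x) (hℓ : ∀ t x, 0 ≤ ℓ t x) :
    stepProb (nnCond w ℓ) t x (x + 1) + stepProb (nnCond w ℓ) t x (x - 1) +
      stepProb (nnCond w ℓ) t x x = 1 := by
  rw [stepProb_nnCond_right, stepProb_nnCond_left, stepProb_nnCond_self]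
  have : 0 < w t x + w t (x - 1) + ℓ t x := by linarith [hw t x, hw t (x - 1), hℓ t x]
  field_simp

lemma isTimeDepConductance_nnCond_loop {K : ℝ} (hK : 1 ≤ K)
    (hw : ∀ t x, w t x ∈ Set.Icc K⁻¹ K) (hℓ : ∀ t x, ℓ t x ∈ Set.Icc K⁻¹ K) :
    IsTimeDepConductance intLoopEdge (nnCond w ℓ) := by
  have hK0 : 0 < K⁻¹ := by positivity
  have key : ∀ t x y, intLoopEdge x y → nnCond w ℓ t x y ∈ Set.Icc K⁻¹ K := by
    intro t x y h
    have h' := abs_le.1 h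
    unfold nnCond
    split_ifs with h1 h2 h3
    exacts [hw _ _, hw _ _, hℓ _ _, by omega]
  have key0 : ∀ t x y, ¬ intLoopEdge x y → nnCond w ℓ t x y = 0 := by
    intro t x y h
    rw [intLoopEdge, abs_le] at h
    exact nnCond_eq_zero w ℓ t x (by omega) (by omega) (by omega)
  refine ⟨fun t x y => nnCond_symm w ℓ t x y, fun t x y => ?_, fun t x y => ⟨fun h => ?_, fun h => ?_⟩,
    K⁻¹, hK0, inv_le_one_of_one_le₀ hK, fun t x y h => ?_⟩
  · by_cases h : intLoopEdge x y
    · exact hK0.le.trans (key t x y h).1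
    · exact (key0 t x y h).ge
  · by_contra h'
    exact h.ne' (key0 t x y h')
  · exact hK0.trans_le (key t x y h).1
  · rw [inv_inv]; exact key t x y h

lemma isTimeDepConductance_nnCond_noLoop {K : ℝ} (hK : 1 ≤ K)
    (hw : ∀ t x, w t x ∈ Set.Icc K⁻¹ K) :
    IsTimeDepConductance intEdge (nnCond w 0) := by
  have hK0 : 0 < K⁻¹ := by positivity
  have key : ∀ t x y, intEdge x y → nnCond w 0 t x y ∈ Set.Icc K⁻¹ K := by
    intro t x y h
    have h' := (abs_eq (by norm_num)).1 h
    unfold nnCond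
    split_ifs with h1 h2 h3
    exacts [hw _ _, hw _ _, by omega, by omega]
  have key0 : ∀ t x y, ¬ intEdge x y → nnCond w 0 t x y = 0 := by
    intro t x y h
    rw [intEdge, abs_eq (by norm_num)] at h
    by_cases hxy : y = x
    · subst hxy; simp [nnCond_self]
    · exact nnCond_eq_zero w 0 t x (by omega) (by omega) hxy
  refine ⟨fun t x y => nnCond_symm w 0 t x y, fun t x y => ?_, fun t x y => ⟨fun h => ?_, fun h => ?_⟩,
    K⁻¹, hK0, inv_le_one_of_one_le₀ hK, fun t x y h => ?_⟩
  · by_cases h : intEdge x y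
    · exact hK0.le.trans (key t x y h).1
    · exact (key0 t x y h).ge
  · by_contra h'
    exact h.ne' (key0 t x y h')
  · exact hK0.trans_le (key t x y h).1
  · rw [inv_inv]; exact key t x y h

end nnCond

/-! ### Exponentially small linear deviations -/

/-- The random variables `M n` deviate linearly from `0` with exponentially small probability only:
`P(|M n| ≥ δ n)` decays exponentially in `n`, for every `δ > 0`. -/
def ExpSmall {Ω : Type*} [MeasurableSpace Ω] (P : Measure Ω) (M : ℕ → Ω → ℝ) : Prop :=
  ∀ δ : ℝ, 0 < δ → ∃ A c : ℝ, 0 ≤ A ∧ 0 < c ∧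
    ∀ n : ℕ, P.real {ω | δ * n ≤ |M n ω|} ≤ A * Real.exp (-c * n)

lemma tendsto_affine_mul_exp_neg (a b : ℝ) {c : ℝ} (hc : 0 < c) :
    Tendsto (fun n : ℕ => (a * n + b) * Real.exp (-c * n)) atTop (𝓝 0) := by
  have h1 := (Real.summable_pow_mul_exp_neg_nat_mul 1 hc).tendsto_atTop_zero.const_mul a
  have h0 := (Real.summable_pow_mul_exp_neg_nat_mul 0 hc).tendsto_atTop_zero.const_mul b
  have := h1.add h0
  simp only [mul_zero, add_zero] at this
  refine this.congr fun n => ?_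
  ring

section ExpSmall

variable {Ω : Type*} [MeasurableSpace Ω] {P : Measure Ω} {M M' : ℕ → Ω → ℝ}

/-- A one-sided exponential Chebyshev bound. -/
lemma measureReal_le_exp_of_lintegral_exp {Z : Ω → ℝ} (hZ : Measurable Z) {θ b r : ℝ} (hθ : 0 < θ)
    (h : ∫⁻ ω, ENNReal.ofReal (Real.exp (θ * Z ω)) ∂P ≤ ENNReal.ofReal (Real.exp b)) :
    P.real {ω | r ≤ Z ω} ≤ Real.exp (b - θ * r) := by
  have hm : Measurable fun ω => ENNReal.ofReal (Real.exp (θ * Z ω)) := by fun_prop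
  have h1 := mul_meas_ge_le_lintegral (μ := P) hm (ENNReal.ofReal (Real.exp (θ * r)))
  have hsub : {ω | r ≤ Z ω} ⊆
      {ω | ENNReal.ofReal (Real.exp (θ * r)) ≤ ENNReal.ofReal (Real.exp (θ * Z ω))} := by
    intro ω hω
    exact ENNReal.ofReal_le_ofReal (Real.exp_le_exp.2 (mul_le_mul_of_nonneg_left hω hθ.le))
  have h2 : ENNReal.ofReal (Real.exp (θ * r)) * P {ω | r ≤ Z ω} ≤ ENNReal.ofReal (Real.exp b) :=
    (mul_le_mul_right (measure_mono hsub) _).trans (h1.trans h)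
  have h3 := ENNReal.toReal_mono ENNReal.ofReal_ne_top h2
  rw [ENNReal.toReal_mul, ENNReal.toReal_ofReal (Real.exp_pos _).le,
    ENNReal.toReal_ofReal (Real.exp_pos _).le] at h3
  rw [Real.exp_sub, le_div_iff₀ (Real.exp_pos _), mul_comm]
  exact h3

variable [IsProbabilityMeasure P]

/-- If the exponential moments of `M n` grow by a factor of at most `1 + C θ²` in each step (as they
do for a martingale whose increments have a uniform exponential moment), then optimizing over `θ` in
Chebyshev's inequality makes linear deviations exponentially unlikely. -/
lemma expSmall_of_exp_step (hM : ∀ n, Measurable (M n)) (h0 : ∀ᵐ ω ∂P, M 0 ω = 0)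
    {θ₀ C : ℝ} (hθ₀ : 0 < θ₀) (hC : 0 ≤ C)
    (step : ∀ θ, |θ| ≤ θ₀ → ∀ n, ∫⁻ ω, ENNReal.ofReal (Real.exp (θ * M (n + 1) ω)) ∂P ≤
      ENNReal.ofReal (1 + C * θ ^ 2) * ∫⁻ ω, ENNReal.ofReal (Real.exp (θ * M n ω)) ∂P) :
    ExpSmall P M := by
  have hmgf : ∀ θ, |θ| ≤ θ₀ → ∀ n : ℕ, ∫⁻ ω, ENNReal.ofReal (Real.exp (θ * M n ω)) ∂P ≤
      ENNReal.ofReal (Real.exp (C * θ ^ 2 * n)) := by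
    intro θ hθ n
    induction n with
    | zero =>
      have : ∫⁻ ω, ENNReal.ofReal (Real.exp (θ * M 0 ω)) ∂P = ∫⁻ _, 1 ∂P :=
        lintegral_congr_ae (h0.mono fun ω hω => by simp [hω])
      rw [this]; simp
    | succ n ih =>
      refine (step θ hθ n).trans ?_
      have h1 : 1 + C * θ ^ 2 ≤ Real.exp (C * θ ^ 2) := by
        linarith [Real.add_one_le_exp (C * θ ^ 2)]
      calc _ ≤ ENNReal.ofReal (Real.exp (C * θ ^ 2)) * ENNReal.ofReal (Real.exp (C * θ ^ 2 * n)) :=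
            mul_le_mul' (ENNReal.ofReal_le_ofReal h1) ih
        _ = _ := by
            rw [← ENNReal.ofReal_mul (Real.exp_pos _).le, ← Real.exp_add]
            congr 2; push_cast; ring
  intro δ hδ
  -- with this `θ`, the error term `C θ² n` is at most half of the gain `θ δ n`
  set θ := min θ₀ (δ / (2 * (C + 1))) with hθdef
  have hθ : 0 < θ := lt_min hθ₀ (by positivity)
  have hθ1 : θ ≤ θ₀ := min_le_left _ _
  have hθ2 : C * θ ≤ δ / 2 := by
    have h2 : θ ≤ δ / (2 * (C + 1)) := min_le_right _ _
    rw [le_div_iff₀ (by positivity)] at h2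
    nlinarith
  refine ⟨2, θ * δ / 2, by norm_num, by positivity, fun n => ?_⟩
  have hbound : ∀ Z : Ω → ℝ, Measurable Z →
      ∫⁻ ω, ENNReal.ofReal (Real.exp (θ * Z ω)) ∂P ≤ ENNReal.ofReal (Real.exp (C * θ ^ 2 * n)) →
      P.real {ω | δ * n ≤ Z ω} ≤ Real.exp (-(θ * δ / 2) * n) := by
    intro Z hZ h
    refine (measureReal_le_exp_of_lintegral_exp hZ hθ h).trans (Real.exp_le_exp.2 ?_)
    have hn : (0 : ℝ) ≤ n := Nat.cast_nonneg n
    have : C * θ * (θ * n) ≤ δ / 2 * (θ * n) := mul_le_mul_of_nonneg_right hθ2 (by positivity)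
    nlinarith
  have hpos := hbound (M n) (hM n) (hmgf θ (by rwa [abs_of_pos hθ]) n)
  have hneg := hbound (fun ω => -M n ω) (hM n).neg (by
    have := hmgf (-θ) (by rwa [abs_neg, abs_of_pos hθ]) n
    simpa using this)
  have hsub : {ω | δ * n ≤ |M n ω|} ⊆ {ω | δ * n ≤ M n ω} ∪ {ω | δ * n ≤ -M n ω} := by
    intro ω hω
    exact le_abs.1 (show δ * n ≤ |M n ω| from hω)
  calc P.real {ω | δ * n ≤ |M n ω|} ≤ _ := measureReal_mono hsub
    _ ≤ _ := measureReal_union_le _ _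
    _ ≤ _ := by linarith

lemma ExpSmall.of_abs_le (h : ExpSmall P M) {K : ℝ}
    (hM' : ∀ n, ∀ᵐ ω ∂P, |M' n ω| ≤ |M n ω| + K) : ExpSmall P M' := by
  intro δ hδ
  obtain ⟨A, c, hA, hc, hAc⟩ := h (δ / 2) (by positivity)
  refine ⟨A + Real.exp (c * (2 * K / δ)), c, by positivity, hc, fun n => ?_⟩
  by_cases hn : (n : ℝ) ≤ 2 * K / δ
  · have h1 : 1 ≤ Real.exp (c * (2 * K / δ)) * Real.exp (-c * n) := by
      rw [← Real.exp_add]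
      apply Real.one_le_exp
      have := mul_le_mul_of_nonneg_left hn hc.le
      linarith
    have h2 : 0 ≤ A * Real.exp (-c * n) := by positivity
    calc _ ≤ (1 : ℝ) := measureReal_le_one
      _ ≤ _ := by rw [add_mul]; linarith
  · have hn' : K ≤ δ / 2 * n := by
      rw [not_le, div_lt_iff₀ hδ] at hn
      linarith
    have hsub : P.real {ω | δ * n ≤ |M' n ω|} ≤ P.real {ω | δ / 2 * n ≤ |M n ω|} := by
      refine ENNReal.toReal_mono (measure_ne_top _ _) (measure_mono_ae ?_)
      filter_upwards [hM' n] with ω hω h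
      change δ * n ≤ |M' n ω| at h
      change δ / 2 * n ≤ |M n ω|
      linarith
    refine (hsub.trans (hAc n)).trans (mul_le_mul_of_nonneg_right ?_ (Real.exp_pos _).le)
    linarith [Real.exp_pos (c * (2 * K / δ))]

lemma ExpSmall.add (h : ExpSmall P M) (h' : ExpSmall P M') :
    ExpSmall P (fun n ω => M n ω + M' n ω) := by
  intro δ hδ
  obtain ⟨A, c, hA, hc, hAc⟩ := h (δ / 2) (by positivity)
  obtain ⟨A', c', hA', hc', hAc'⟩ := h' (δ / 2) (by positivity)
  refine ⟨A + A', min c c', by positivity, lt_min hc hc', fun n => ?_⟩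
  have hsub : {ω | δ * n ≤ |M n ω + M' n ω|} ⊆
      {ω | δ / 2 * n ≤ |M n ω|} ∪ {ω | δ / 2 * n ≤ |M' n ω|} := by
    intro ω hω
    by_contra hcon
    simp only [Set.mem_union, Set.mem_ofPred_eq, not_or, not_le] at hcon hω
    linarith [abs_add_le (M n ω) (M' n ω)]
  have hn : (0 : ℝ) ≤ n := Nat.cast_nonneg n
  have e1 : Real.exp (-c * n) ≤ Real.exp (-(min c c') * n) :=
    Real.exp_le_exp.2 (mul_le_mul_of_nonneg_right (neg_le_neg (min_le_left _ _)) hn)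
  have e2 : Real.exp (-c' * n) ≤ Real.exp (-(min c c') * n) :=
    Real.exp_le_exp.2 (mul_le_mul_of_nonneg_right (neg_le_neg (min_le_right _ _)) hn)
  calc P.real {ω | δ * n ≤ |M n ω + M' n ω|} ≤ _ := measureReal_mono hsub
    _ ≤ _ := measureReal_union_le _ _
    _ ≤ A * Real.exp (-c * n) + A' * Real.exp (-c' * n) := add_le_add (hAc n) (hAc' n)
    _ ≤ A * Real.exp (-(min c c') * n) + A' * Real.exp (-(min c c') * n) :=
        add_le_add (mul_le_mul_of_nonneg_left e1 hA) (mul_le_mul_of_nonneg_left e2 hA')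
    _ = _ := by ring

lemma ExpSmall.const_mul (h : ExpSmall P M) (a : ℝ) : ExpSmall P (fun n ω => a * M n ω) := by
  intro δ hδ
  obtain ⟨A, c, hA, hc, hAc⟩ := h (δ / (|a| + 1)) (by positivity)
  refine ⟨A, c, hA, hc, fun n => (measureReal_mono fun ω hω => ?_).trans (hAc n)⟩
  change δ * n ≤ |a * M n ω| at hω
  change δ / (|a| + 1) * n ≤ |M n ω|
  rw [abs_mul] at hω
  rw [div_mul_eq_mul_div, div_le_iff₀ (by positivity)]
  linarith [abs_nonneg (M n ω)]

/-- Borel–Cantelli. -/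
lemma ExpSmall.tendsto_div (h : ExpSmall P M) :
    ∀ᵐ ω ∂P, Tendsto (fun n : ℕ => M n ω / n) atTop (𝓝 0) := by
  have key : ∀ k : ℕ, ∀ᵐ ω ∂P, ∀ᶠ n : ℕ in atTop, ¬ (1 / ((k : ℝ) + 1) * n ≤ |M n ω|) := by
    intro k
    obtain ⟨A, c, hA, hc, hAc⟩ := h (1 / ((k : ℝ) + 1)) (by positivity)
    have hs : Summable fun n : ℕ => A * Real.exp (-c * n) := by
      have := (Real.summable_pow_mul_exp_neg_nat_mul 0 hc).mul_left A
      simpa using this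
    have hne : ∑' n : ℕ, P {ω | 1 / ((k : ℝ) + 1) * n ≤ |M n ω|} ≠ ∞ := by
      refine ne_top_of_le_ne_top hs.tsum_ofReal_ne_top (ENNReal.tsum_le_tsum fun n => ?_)
      rw [← ofReal_measureReal]
      exact ENNReal.ofReal_le_ofReal (hAc n)
    filter_upwards [ae_eventually_notMem hne] with ω hω using hω
  filter_upwards [ae_all_iff.2 key] with ω hω
  rw [Metric.tendsto_atTop']
  intro ε hε
  obtain ⟨k, hk⟩ := exists_nat_one_div_lt hε
  obtain ⟨N, hN⟩ := eventually_atTop.1 (hω k)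
  refine ⟨N, fun n hn => ?_⟩
  have h1 := not_le.1 (hN n hn.le)
  have hn0 : (0 : ℝ) < n := by exact_mod_cast (Nat.zero_le N).trans_lt hn
  rw [Real.dist_eq, sub_zero, abs_div, abs_of_pos hn0, div_lt_iff₀ hn0]
  exact h1.trans_le (mul_le_mul_of_nonneg_right hk.le hn0.le)

end ExpSmall

/-! ### Heat kernel bounds violated by ballistic walks -/

lemma one_le_ballVol (x : ℤ) {r : ℝ} (hr : 0 ≤ r) : 1 ≤ ballVol x r := by
  have hf : (Metric.closedBall x r).Finite := by
    rw [Int.closedBall_eq_Icc]; exact Set.finite_Icc _ _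
  have : 0 < (Metric.closedBall x r).ncard :=
    (Set.ncard_pos hf).2 ⟨x, Metric.mem_closedBall_self hr⟩
  unfold ballVol
  exact_mod_cast this

lemma ballVol_le (x : ℤ) {r : ℝ} (hr : 0 ≤ r) : ballVol x r ≤ 2 * r + 1 := by
  unfold ballVol
  rw [Int.closedBall_eq_Icc, ← Finset.coe_Icc, Set.ncard_coe_finset, Int.card_Icc]
  have h1 := Int.floor_le ((x : ℝ) + r)
  have h2 := Int.le_ceil ((x : ℝ) - r)
  have h3 : (0 : ℤ) ≤ ⌊(x : ℝ) + r⌋ + 1 - ⌈(x : ℝ) - r⌉ := by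
    have : ⌈(x : ℝ) - r⌉ ≤ x := Int.ceil_le.2 (by linarith)
    have : x ≤ ⌊(x : ℝ) + r⌋ := Int.le_floor.2 (by linarith)
    omega
  have h4 : (((⌊(x : ℝ) + r⌋ + 1 - ⌈(x : ℝ) - r⌉).toNat : ℤ) : ℝ) =
      ((⌊(x : ℝ) + r⌋ + 1 - ⌈(x : ℝ) - r⌉ : ℤ) : ℝ) := by rw [Int.toNat_of_nonneg h3]
  rw [Int.cast_natCast] at h4
  rw [h4]; push_cast; linarith

/-- At distance at least `κ t`, the Gaussian upper bound is exponentially small in `t`. -/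
lemma gaussUpper_le {C₄ C₅ t κ : ℝ} (h4 : 0 < C₄) (h5 : 0 < C₅) (ht : 0 < t) (hκ : 0 < κ)
    (hκ1 : κ ≤ 1) {x y : ℤ} (hd : κ * t ≤ dist x y) :
    gaussUpper C₄ C₅ t x y ≤ C₄ * Real.exp (-(C₅ * κ ^ 2) * t) := by
  have hb : C₄ / ballVol x (√t) ≤ C₄ :=
    div_le_self h4.le (one_le_ballVol x (Real.sqrt_nonneg t))
  have hd0 : 0 ≤ dist x y := dist_nonneg
  have hκ2 : κ ^ 2 * t ≤ κ * t := mul_le_mul_of_nonneg_right (by nlinarith) ht.le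
  unfold gaussUpper
  split_ifs with h
  · refine mul_le_mul hb (Real.exp_le_exp.2 ?_) (Real.exp_pos _).le h4.le
    have h1 : dist x y ≤ dist x y * max 1 (Real.log (dist x y / t)) :=
      le_mul_of_one_le_right hd0 (le_max_left _ _)
    have h2 : κ ^ 2 * t ≤ dist x y * max 1 (Real.log (dist x y / t)) := by linarith
    have h3 := mul_le_mul_of_nonneg_left h2 h5.le
    linarith
  · refine mul_le_mul hb (Real.exp_le_exp.2 ?_) (Real.exp_pos _).le h4.le
    have h1 : κ ^ 2 * t ≤ dist x y ^ 2 / t := by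
      rw [le_div_iff₀ ht]
      have := pow_le_pow_left₀ (by positivity) hd 2
      linarith [this, mul_pow κ t 2]
    have h3 := mul_le_mul_of_nonneg_left h1 h5.le
    linarith

section HeatKernel

variable {Ω 𝕋 : Type*} [MeasurableSpace Ω] {P : Measure Ω}
  {μ : 𝕋 → ℤ → ℤ → ℝ} {X : 𝕋 → Ω → ℤ} {time : 𝕋 → ℝ} {tn : ℕ → 𝕋} {x₀ : ℤ}

lemma not_onDiagLowerBound (htn : ∀ n, time (tn n) = n) (hW : ∀ t y, 1 ≤ vertexWeight μ t y)
    {A c : ℝ} (hc : 0 < c) (hA : ∀ n, P.real {ω | X (tn n) ω = x₀} ≤ A * Real.exp (-c * n)) :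
    ¬ OnDiagLowerBound time (heatKernel μ P X) x₀ := by
  rintro ⟨c₆, hc₆, h⟩
  have hlim := tendsto_affine_mul_exp_neg (2 * A) A hc
  obtain ⟨n, hn, hn1⟩ := ((hlim.eventually (gt_mem_nhds hc₆)).and (eventually_ge_atTop 1)).exists
  have hn1' : (1 : ℝ) ≤ n := by exact_mod_cast hn1
  have h1 := h (tn n) (by rw [htn]; linarith)
  rw [htn] at h1
  have h2 : heatKernel μ P X (tn n) x₀ ≤ A * Real.exp (-c * n) :=
    (div_le_self measureReal_nonneg (hW _ _)).trans (hA n)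
  have hb0 := one_le_ballVol x₀ (Real.sqrt_nonneg (n : ℝ))
  have hb : ballVol x₀ √(n : ℝ) ≤ 2 * n + 1 := by
    refine (ballVol_le x₀ (Real.sqrt_nonneg _)).trans ?_
    have : √(n : ℝ) ≤ n := Real.sqrt_le_iff.2 ⟨by linarith, by nlinarith⟩
    linarith
  have h3 := h1.trans h2
  rw [div_le_iff₀ (by linarith)] at h3
  have hA0 : 0 ≤ A * Real.exp (-c * n) := measureReal_nonneg.trans (hA n)
  have h4 := mul_le_mul_of_nonneg_left hb hA0
  nlinarith

/-- By ballisticity, at time `n` the walk is with high probability at one of at most `O(n)` points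
at distance at least `κ n` from its starting point, so one of them has heat kernel at least of order
`1 / n`; there the Gaussian upper bound is exponentially small. -/
lemma not_offDiagUpperBound [IsProbabilityMeasure P] [Preorder 𝕋] (htn : ∀ n, time (tn n) = n)
    (htn' : Tendsto tn atTop atTop) {W : ℝ}
    (hW : ∀ t y, vertexWeight μ t y ∈ Set.Icc 1 W) (hX : ∀ t, Measurable (X t))
    (hball : IsBallistic time P X) :
    ¬ OffDiagUpperBound time (heatKernel μ P X) x₀ := by
  rintro ⟨C₄, C₅, h4, h5, h⟩
  obtain ⟨v, hv, hlim⟩ := hball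
  have hv0 : 0 < |v| := abs_pos.2 hv
  set κ := min 1 (|v| / 2) with hκdef
  have hκ : 0 < κ := lt_min one_pos (by positivity)
  have hκ1 : κ ≤ 1 := min_le_left _ _
  have hκ2 : κ ≤ |v| / 2 := min_le_right _ _
  have hW1 : 1 ≤ W := (hW (tn 0) 0).1.trans (hW (tn 0) 0).2
  have hmeas : TendstoInMeasure P (fun n ω => ((X (tn n) ω : ℝ) - x₀) / n) atTop (fun _ => v) := by
    refine tendstoInMeasure_of_tendsto_ae (fun n => ?_) ?_
    · have : Measurable fun ω => (X (tn n) ω : ℝ) := (measurable_of_countable _).comp (hX _)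
      exact ((this.sub_const _).div_const _).aestronglyMeasurable
    · filter_upwards [hlim] with ω hω
      have h1 := hω.comp htn'
      have h2 : Tendsto (fun n : ℕ => (x₀ : ℝ) / n) atTop (𝓝 0) :=
        tendsto_const_div_atTop_nhds_zero_nat _
      have h3 := h1.sub h2
      rw [sub_zero] at h3
      refine h3.congr fun n => ?_
      simp only [Function.comp, htn, sub_div]
  have hbad := (tendstoInMeasure_iff_measureReal_dist.1 hmeas) κ hκ
  have hgood := tendsto_affine_mul_exp_neg (W * C₄ * (2 * (|v| + 1))) (W * C₄ * 3)
    (show 0 < C₅ * κ ^ 2 by positivity)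
  obtain ⟨n, ⟨hn, hn'⟩, hn1⟩ := (((hbad.eventually (gt_mem_nhds (show (0 : ℝ) < 1 / 2 by norm_num))).and
    (hgood.eventually (gt_mem_nhds (show (0 : ℝ) < 1 / 2 by norm_num)))).and
      (eventually_ge_atTop 1)).exists
  have hn0 : (0 : ℝ) < n := by exact_mod_cast hn1
  set N : ℤ := ⌈(|v| + 1) * n⌉ with hN
  set S : Finset ℤ := (Finset.Icc (x₀ - N) (x₀ + N)).filter fun y => κ * n ≤ dist x₀ y with hS
  have hN0 : 0 ≤ N := Int.ceil_nonneg (by positivity)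
  have hcard : (S.card : ℝ) ≤ 2 * (|v| + 1) * n + 3 := by
    have h1 : S.card ≤ (2 * N + 1).toNat := by
      refine (Finset.card_filter_le _ _).trans ?_
      rw [Int.card_Icc]
      apply le_of_eq; congr 1; ring
    have h2 : ((2 * N + 1).toNat : ℝ) = 2 * N + 1 := by
      have : (((2 * N + 1).toNat : ℤ) : ℝ) = ((2 * N + 1 : ℤ) : ℝ) := by
        rw [Int.toNat_of_nonneg (by omega)]
      push_cast at this
      simpa using this
    have h3 : (N : ℝ) < (|v| + 1) * n + 1 := Int.ceil_lt_add_one _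
    have h4 : (S.card : ℝ) ≤ ((2 * N + 1).toNat : ℝ) := by exact_mod_cast h1
    linarith
  have hcover : (Set.univ : Set Ω) ⊆
      {ω | κ ≤ dist (((X (tn n) ω : ℝ) - x₀) / n) v} ∪ ⋃ y ∈ S, {ω | X (tn n) ω = y} := by
    intro ω _
    by_cases hω : κ ≤ dist (((X (tn n) ω : ℝ) - x₀) / n) v
    · exact Or.inl hω
    · right
      rw [not_le, Real.dist_eq] at hω
      have hd : dist x₀ (X (tn n) ω) = |((X (tn n) ω : ℝ) - x₀) / n| * n := by
        rw [abs_div, abs_of_pos hn0, div_mul_cancel₀ _ hn0.ne', Int.dist_eq, abs_sub_comm]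
      have hlow : κ ≤ |((X (tn n) ω : ℝ) - x₀) / n| := by
        have := abs_sub_abs_le_abs_sub v (((X (tn n) ω : ℝ) - x₀) / n)
        rw [abs_sub_comm v] at this
        linarith
      have hup : |((X (tn n) ω : ℝ) - x₀) / n| ≤ |v| + 1 := by
        have := abs_sub_abs_le_abs_sub (((X (tn n) ω : ℝ) - x₀) / n) v
        linarith
      have hdist_le : dist x₀ (X (tn n) ω) ≤ N := by
        rw [hd]
        exact (mul_le_mul_of_nonneg_right hup hn0.le).trans (Int.le_ceil _)
      have hdist_le' : |x₀ - X (tn n) ω| ≤ N := by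
        rw [Int.dist_eq] at hdist_le
        exact_mod_cast hdist_le
      simp only [Set.mem_iUnion, Set.mem_ofPred_eq, exists_prop, exists_eq_right', hS,
        Finset.mem_filter, Finset.mem_Icc]
      refine ⟨by have := abs_le.1 hdist_le'; omega, ?_⟩
      rw [hd]
      exact mul_le_mul_of_nonneg_right hlow hn0.le
  have hpt : ∀ y ∈ S, P.real {ω | X (tn n) ω = y} ≤ W * (C₄ * Real.exp (-(C₅ * κ ^ 2) * n)) := by
    intro y hy
    have hy' : κ * n ≤ dist x₀ y := (Finset.mem_filter.1 hy).2
    have hne : y ≠ x₀ := by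
      rintro rfl
      rw [dist_self] at hy'
      linarith [mul_pos hκ hn0]
    have h1 := h (tn n) y (by rw [htn]; exact hn0) hne
    rw [htn] at h1
    have h2 := h1.trans (gaussUpper_le h4 h5 hn0 hκ hκ1 hy')
    have hw := hW (tn n) y
    rw [heatKernel, div_le_iff₀ (by linarith [hw.1])] at h2
    refine h2.trans ?_
    rw [mul_comm]
    exact mul_le_mul_of_nonneg_right hw.2 (by positivity)
  have hsum : P.real (⋃ y ∈ S, {ω | X (tn n) ω = y}) ≤
      (W * C₄ * (2 * (|v| + 1)) * n + W * C₄ * 3) * Real.exp (-(C₅ * κ ^ 2) * n) := by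
    calc _ ≤ ∑ y ∈ S, P.real {ω | X (tn n) ω = y} := measureReal_biUnion_finset_le _ _
      _ ≤ S.card • (W * (C₄ * Real.exp (-(C₅ * κ ^ 2) * n))) := Finset.sum_le_card_nsmul _ _ _ hpt
      _ ≤ (2 * (|v| + 1) * n + 3) * (W * (C₄ * Real.exp (-(C₅ * κ ^ 2) * n))) := by
          rw [nsmul_eq_mul]
          exact mul_le_mul_of_nonneg_right hcard (by positivity)
      _ = _ := by ring
  have htot : (1 : ℝ) ≤ P.real {ω | κ ≤ dist (((X (tn n) ω : ℝ) - x₀) / n) v} +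
      P.real (⋃ y ∈ S, {ω | X (tn n) ω = y}) := by
    calc (1 : ℝ) = P.real Set.univ := by simp
      _ ≤ _ := (measureReal_mono hcover).trans (measureReal_union_le _ _)
  linarith

end HeatKernel

lemma eventually_ne_of_tendsto_div {α : Type*} {l : Filter α} {f time : α → ℝ} {v : ℝ}
    (htime : Tendsto time l atTop) (hv : v ≠ 0) (hf : Tendsto (fun a => f a / time a) l (𝓝 v))
    (z : ℝ) : ∀ᶠ a in l, f a ≠ z := by
  have hz : Tendsto (fun a => z / time a) l (𝓝 0) := htime.const_div_atTop z
  have h := (hf.sub hz).eventually_ne (show v - 0 ≠ 0 by simpa using hv)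
  filter_upwards [h] with a ha hfa
  exact ha (by rw [hfa, sub_self])

/-! ### The discrete time walk -/

section Discrete

variable {Ω : Type*} [MeasurableSpace Ω] {P : Measure Ω}

/-- The Markov property in integrated form. -/
lemma IsDiscreteWalk.lintegral_succ {V : Type*} [MeasurableSpace V] [Countable V]
    [MeasurableSingletonClass V] {μ : ℕ → V → V → ℝ} {X : ℕ → Ω → V}
    (hX : IsDiscreteWalk μ P X) (n : ℕ) (G : V → ℝ≥0∞) :
    ∫⁻ ω, G (X (n + 1) ω) ∂P =
      ∫⁻ ω, ∑' y, ENNReal.ofReal (stepProb μ n (X n ω) y) * G y ∂P := by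
  have hW : Measurable fun ω => fun i : Fin (n + 1) => X i ω :=
    measurable_pi_lambda _ fun i => hX.measurable i
  have hZ : Measurable fun ω => ((fun i : Fin (n + 1) => X i ω), X (n + 1) ω) :=
    hW.prodMk (hX.measurable _)
  have e1 : ∫⁻ ω, G (X (n + 1) ω) ∂P = ∫⁻ z : (Fin (n + 1) → V) × V, G z.2
      ∂(P.map fun ω => ((fun i : Fin (n + 1) => X i ω), X (n + 1) ω)) := by
    rw [lintegral_map (measurable_of_countable _) hZ]
  have e2 : ∫⁻ ω, ∑' y, ENNReal.ofReal (stepProb μ n (X n ω) y) * G y ∂P =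
      ∫⁻ z : Fin (n + 1) → V, ∑' y, ENNReal.ofReal (stepProb μ n (z (Fin.last n)) y) * G y
        ∂(P.map fun ω => fun i : Fin (n + 1) => X i ω) := by
    rw [lintegral_map (measurable_of_countable _) hW]
    simp
  rw [e1, e2, lintegral_countable', lintegral_countable', ENNReal.tsum_prod']
  refine tsum_congr fun z => ?_
  rw [← ENNReal.tsum_mul_right]
  refine tsum_congr fun y => ?_
  rw [Measure.map_apply hZ (measurableSet_singleton _),
    Measure.map_apply hW (measurableSet_singleton _)]
  have h := hX.markov n (fun i => if hi : i < n + 1 then z ⟨i, hi⟩ else y)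
  have s1 : {ω | ∀ i ≤ n + 1, X i ω = if hi : i < n + 1 then z ⟨i, hi⟩ else y} =
      (fun ω => ((fun i : Fin (n + 1) => X i ω), X (n + 1) ω)) ⁻¹' {(z, y)} := by
    ext ω
    simp only [Set.mem_ofPred_eq, Set.mem_preimage, Set.mem_singleton_iff, Prod.mk.injEq]
    constructor
    · intro h
      refine ⟨funext fun i => ?_, ?_⟩
      · rw [h i i.2.le, dif_pos i.2]
      · rw [h (n + 1) le_rfl, dif_neg (lt_irrefl _)]
    · rintro ⟨h1, h2⟩ i hi
      split_ifs with hi'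
      · exact congrFun h1 ⟨i, hi'⟩
      · obtain rfl : i = n + 1 := by omega
        exact h2
  have s2 : {ω | ∀ i ≤ n, X i ω = if hi : i < n + 1 then z ⟨i, hi⟩ else y} =
      (fun ω => fun i : Fin (n + 1) => X i ω) ⁻¹' {z} := by
    ext ω
    simp only [Set.mem_ofPred_eq, Set.mem_preimage, Set.mem_singleton_iff]
    constructor
    · intro h
      refine funext fun i => ?_
      rw [h i (Nat.lt_succ_iff.1 i.2), dif_pos i.2]
    · intro h1 i hi
      rw [dif_pos (Nat.lt_succ_iff.2 hi)]
      exact congrFun h1 ⟨i, Nat.lt_succ_iff.2 hi⟩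
  rw [s1, s2] at h
  rw [h, dif_pos (Nat.lt_succ_self n), dif_neg (lt_irrefl _)]
  change _ = ENNReal.ofReal (stepProb μ n (z ⟨n, _⟩) y) * G y * _
  ring

variable [IsProbabilityMeasure P] {X : ℕ → Ω → ℤ} {x₀ : ℤ}

/-- A space-time harmonic function with bounded increments, evaluated along the walk, is a
martingale with bounded increments, and hence has exponentially small linear deviations. -/
lemma IsDiscreteWalk.expSmall_harmonic {w ℓ : ℕ → ℤ → ℝ} (hw : ∀ n x, 0 < w n x)
    (hℓ : ∀ n x, 0 ≤ ℓ n x) {F : ℕ → ℤ → ℝ} {K : ℝ} (hK : 0 < K)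
    (hb : ∀ n x y, |y - x| ≤ 1 → |F (n + 1) y - F n x| ≤ K)
    (hF : ∀ n x, stepProb (nnCond w ℓ) n x (x + 1) * F (n + 1) (x + 1) +
      stepProb (nnCond w ℓ) n x (x - 1) * F (n + 1) (x - 1) +
      stepProb (nnCond w ℓ) n x x * F (n + 1) x = F n x)
    (hX : IsDiscreteWalk (nnCond w ℓ) P X) (h0 : ∀ᵐ ω ∂P, X 0 ω = x₀) :
    ExpSmall P (fun n ω => F n (X n ω) - F 0 x₀) := by
  refine expSmall_of_exp_step (θ₀ := 1 / K) (C := K ^ 2) (fun n => ?_) ?_ (by positivity)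
    (by positivity) fun θ hθ n => ?_
  · exact ((measurable_of_countable (F n)).comp (hX.measurable n)).sub_const _
  · filter_upwards [h0] with ω hω
    rw [hω, sub_self]
  have hexp : ∀ D, |D| ≤ K → Real.exp (θ * D) ≤ 1 + θ * D + K ^ 2 * θ ^ 2 := by
    intro D hD
    have h1 : |θ * D| ≤ 1 := by
      rw [abs_mul]
      calc |θ| * |D| ≤ 1 / K * K := mul_le_mul hθ hD (abs_nonneg _) (by positivity)
        _ = 1 := by field_simp
    have h2 := (abs_le.1 (Real.abs_exp_sub_one_sub_id_le h1)).2
    have h3 : (θ * D) ^ 2 ≤ K ^ 2 * θ ^ 2 := by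
      have : D ^ 2 ≤ K ^ 2 := sq_le_sq' (by linarith [(abs_le.1 hD).1]) (abs_le.1 hD).2
      nlinarith [sq_nonneg θ]
    linarith
  rw [hX.lintegral_succ n fun y => ENNReal.ofReal (Real.exp (θ * (F (n + 1) y - F 0 x₀))),
    ← lintegral_const_mul' _ _ ENNReal.ofReal_ne_top]
  refine lintegral_mono fun ω => ?_
  simp only
  set x := X n ω
  have hp := stepProb_nnCond_nonneg n x hw hℓ
  have hsum := stepProb_nnCond_add n x hw hℓ
  have hmean := hF n x
  rw [tsum_stepProb_nnCond_mul, ← ENNReal.ofReal_mul (hp _), ← ENNReal.ofReal_mul (hp _),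
    ← ENNReal.ofReal_mul (hp _), ← ENNReal.ofReal_add (by have := hp (x + 1); positivity)
      (by have := hp (x - 1); positivity), ← ENNReal.ofReal_add
      (by have := hp (x + 1); have := hp (x - 1); positivity) (by have := hp x; positivity),
    ← ENNReal.ofReal_mul (by positivity)]
  refine ENNReal.ofReal_le_ofReal ?_
  have hsplit : ∀ y, Real.exp (θ * (F (n + 1) y - F 0 x₀)) =
      Real.exp (θ * (F n x - F 0 x₀)) * Real.exp (θ * (F (n + 1) y - F n x)) := by
    intro y
    rw [← Real.exp_add]; congr 1; ring
  rw [hsplit, hsplit, hsplit]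
  have e1 := mul_le_mul_of_nonneg_left (hexp _ (hb n x (x + 1) (by simp))) (hp (x + 1))
  have e2 := mul_le_mul_of_nonneg_left (hexp _ (hb n x (x - 1) (by simp))) (hp (x - 1))
  have e3 := mul_le_mul_of_nonneg_left (hexp _ (hb n x x (by simp))) (hp x)
  generalize stepProb (nnCond w ℓ) n x (x + 1) = p₁ at *
  generalize stepProb (nnCond w ℓ) n x (x - 1) = p₂ at *
  generalize stepProb (nnCond w ℓ) n x x = p₃ at *
  have key : p₁ * Real.exp (θ * (F (n + 1) (x + 1) - F n x)) +
      p₂ * Real.exp (θ * (F (n + 1) (x - 1) - F n x)) +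
      p₃ * Real.exp (θ * (F (n + 1) x - F n x)) ≤ 1 + K ^ 2 * θ ^ 2 := by
    refine (add_le_add (add_le_add e1 e2) e3).trans (le_of_eq ?_)
    linear_combination (1 + K ^ 2 * θ ^ 2 - θ * F n x) * hsum + θ * hmean
  have := mul_le_mul_of_nonneg_left key (Real.exp_pos (θ * (F n x - F 0 x₀))).le
  linarith

/-- Exponentially small deviations from a nonzero speed give all the assertions about a walk in
discrete time. -/
lemma discrete_conclusion {μ : ℕ → ℤ → ℤ → ℝ} {W v : ℝ}
    (hW : ∀ t y, vertexWeight μ t y ∈ Set.Icc 1 W) (hX : ∀ n, Measurable (X n)) (hv : v ≠ 0)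
    (h : ExpSmall P fun n ω => (X n ω : ℝ) - x₀ - v * n) :
    IsBallistic (fun t : ℕ => (t : ℝ)) P X ∧ IsTransientDiscrete P X ∧
      ¬ OnDiagLowerBound (fun t : ℕ => (t : ℝ)) (heatKernel μ P X) x₀ ∧
      ¬ OffDiagUpperBound (fun t : ℕ => (t : ℝ)) (heatKernel μ P X) x₀ := by
  have hlim : ∀ᵐ ω ∂P, Tendsto (fun n : ℕ => (X n ω : ℝ) / n) atTop (𝓝 v) := by
    filter_upwards [h.tendsto_div] with ω hω
    have h1 := (hω.add (tendsto_const_div_atTop_nhds_zero_nat (x₀ : ℝ))).add_const v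
    simp only [add_zero, zero_add] at h1
    refine h1.congr' ?_
    filter_upwards [eventually_gt_atTop 0] with n hn
    have : (n : ℝ) ≠ 0 := by exact_mod_cast hn.ne'
    field_simp
    ring
  have hball : IsBallistic (fun t : ℕ => (t : ℝ)) P X := ⟨v, hv, hlim⟩
  refine ⟨hball, ?_, ?_, not_offDiagUpperBound (tn := id) (fun n => rfl) tendsto_id hW hX hball⟩
  · filter_upwards [hlim] with ω hω
    have h1 := eventually_ne_of_tendsto_div tendsto_natCast_atTop_atTop hv hω (X 0 ω)
    rw [← Nat.cofinite_eq_atTop, eventually_cofinite] at h1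
    refine h1.subset fun n hn => ?_
    simpa using hn
  · obtain ⟨A, c, -, hc, hA⟩ := h |v| (abs_pos.2 hv)
    refine not_onDiagLowerBound (tn := id) (A := A) (fun n => rfl) (fun t y => (hW t y).1) hc
      fun n => (measureReal_mono fun ω hω => ?_).trans (hA n)
    have hω' : X n ω = x₀ := hω
    change |v| * n ≤ |(X n ω : ℝ) - x₀ - v * n|
    rw [hω', sub_self, zero_sub, abs_neg, abs_mul, Nat.abs_cast]

end Discrete

/-! ### Conductances alternating in space and time, with unequal loops -/

/-- The weight `1 + e` or `1` of the edge `{x, x + 1}` at time `n`, according to the parity of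
`x + n`. -/
noncomputable def altEdge (e : ℝ) (n : ℕ) (x : ℤ) : ℝ := if Even (x + n) then 1 + e else 1

/-- The weight `L` or `2 L` of the loop at `x` at time `n`, according to the parity of `x + n`. -/
noncomputable def altLoop (L : ℝ) (n : ℕ) (x : ℤ) : ℝ := if Even (x + n) then L else 2 * L

section Alternating

variable {e L : ℝ}

lemma altEdge_mem (he : 0 ≤ e) (n : ℕ) (x : ℤ) : altEdge e n x ∈ Set.Icc 1 (1 + e) := by
  unfold altEdge
  split_ifs <;> constructor <;> linarith

lemma altLoop_mem (hL : 0 ≤ L) (n : ℕ) (x : ℤ) : altLoop L n x ∈ Set.Icc L (2 * L) := by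
  unfold altLoop
  split_ifs <;> constructor <;> linarith

/-- The speed of the walk among the alternating conductances. -/
noncomputable def altSpeed (e L : ℝ) : ℝ := e / (3 * (2 + e) + 4 * L)

/-- The corrected, compensated position of the walk, a space-time harmonic function. The
correction, supported on `x + n` even, solves the Poisson equation for the two-state chain formed by
the parity of `x + n`, which changes exactly when the walk uses a loop. -/
noncomputable def altHarmonic (e L : ℝ) (n : ℕ) (x : ℤ) : ℝ :=
  x - altSpeed e L * n +
    if Even (x + n) then (e - altSpeed e L * (2 + e + L)) / L else 0

lemma altHarmonic_harmonic (he : 0 < e) (hL : 0 < L) (n : ℕ) (x : ℤ) :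
    stepProb (nnCond (altEdge e) (altLoop L)) n x (x + 1) * altHarmonic e L (n + 1) (x + 1) +
      stepProb (nnCond (altEdge e) (altLoop L)) n x (x - 1) * altHarmonic e L (n + 1) (x - 1) +
      stepProb (nnCond (altEdge e) (altLoop L)) n x x * altHarmonic e L (n + 1) x =
      altHarmonic e L n x := by
  rw [stepProb_nnCond_right, stepProb_nnCond_left, stepProb_nnCond_self]
  unfold altHarmonic altEdge altLoop altSpeed
  by_cases h : Even (x + n)
  · have h1 : Even (x + 1 + ((n + 1 : ℕ) : ℤ)) := by
      obtain ⟨k, hk⟩ := h; exact ⟨k + 1, by push_cast; omega⟩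
    have h2 : Even (x - 1 + ((n + 1 : ℕ) : ℤ)) := by
      obtain ⟨k, hk⟩ := h; exact ⟨k, by push_cast; omega⟩
    have h3 : ¬ Even (x + ((n + 1 : ℕ) : ℤ)) := by
      rintro ⟨j, hj⟩; obtain ⟨k, hk⟩ := h; push_cast at hj; omega
    have h4 : ¬ Even (x - 1 + n) := by
      rintro ⟨j, hj⟩; obtain ⟨k, hk⟩ := h; omega
    rw [if_pos h1, if_pos h2, if_neg h3, if_pos h, if_neg h4, if_pos h, if_pos h]
    push_cast
    field_simp
    ring
  · obtain ⟨k, hk⟩ := Int.not_even_iff_odd.1 h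
    have h1 : ¬ Even (x + 1 + ((n + 1 : ℕ) : ℤ)) := by
      rintro ⟨j, hj⟩; push_cast at hj; omega
    have h2 : ¬ Even (x - 1 + ((n + 1 : ℕ) : ℤ)) := by
      rintro ⟨j, hj⟩; push_cast at hj; omega
    have h3 : Even (x + ((n + 1 : ℕ) : ℤ)) := ⟨k + 1, by push_cast; omega⟩
    have h4 : Even (x - 1 + n) := ⟨k, by omega⟩
    rw [if_neg h1, if_neg h2, if_pos h3, if_neg h, if_pos h4, if_neg h, if_neg h]
    push_cast
    field_simp
    ring

lemma IsDiscreteWalk.expSmall_altSpeed {Ω : Type*} [MeasurableSpace Ω] {P : Measure Ω}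
    [IsProbabilityMeasure P] {X : ℕ → Ω → ℤ} {x₀ : ℤ} (he : 0 < e) (hL : 0 < L)
    (hX : IsDiscreteWalk (nnCond (altEdge e) (altLoop L)) P X) (h0 : ∀ᵐ ω ∂P, X 0 ω = x₀) :
    ExpSmall P fun n ω => (X n ω : ℝ) - x₀ - altSpeed e L * n := by
  set v := altSpeed e L with hv
  set g := (e - v * (2 + e + L)) / L with hg
  have hcorr : ∀ n x, altHarmonic e L n x - (x - v * n) = 0 ∨
      altHarmonic e L n x - (x - v * n) = g := by
    intro n x
    unfold altHarmonic
    split_ifs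
    · right; rw [← hv, ← hg]; ring
    · left; rw [← hv]; ring
  have hcorr' : ∀ n x, |altHarmonic e L n x - (x - v * n)| ≤ |g| := by
    intro n x
    rcases hcorr n x with h | h <;> rw [h]
    simp
  refine (hX.expSmall_harmonic (fun n x => by linarith [(altEdge_mem he.le n x).1])
    (fun n x => by linarith [(altLoop_mem hL.le n x).1]) (F := altHarmonic e L)
    (K := 1 + |v| + 2 * |g|) (by positivity) (fun n x y hxy => ?_)
    (altHarmonic_harmonic he hL) h0).of_abs_le (K := 2 * |g|) fun n => ae_of_all _ fun ω => ?_
  · have h1 := hcorr' (n + 1) y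
    have h2 := hcorr' n x
    have hxy' : |(y : ℝ) - x| ≤ 1 := by exact_mod_cast hxy
    push_cast at h1
    rw [abs_le] at h1 h2 hxy' ⊢
    constructor <;> linarith [le_abs_self v, neg_abs_le v]
  · have h1 := hcorr' n (X n ω)
    have h2 := hcorr' 0 x₀
    have e1 : (X n ω : ℝ) - x₀ - v * n = (altHarmonic e L n (X n ω) - altHarmonic e L 0 x₀) -
      (altHarmonic e L n (X n ω) - (X n ω - v * n)) +
      (altHarmonic e L 0 x₀ - (x₀ - v * (0 : ℕ))) := by push_cast; ring
    rw [e1]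
    refine (abs_add_le _ _).trans ?_
    have := abs_sub (altHarmonic e L n (X n ω) - altHarmonic e L 0 x₀)
      (altHarmonic e L n (X n ω) - (X n ω - v * n))
    linarith

end Alternating

/-! ### The exponential distribution -/

lemma expMeasure_one_eq :
    expMeasure 1 = (volume.restrict (Set.Ioi 0)).withDensity
      fun x => ENNReal.ofReal (Real.exp (-x)) := by
  have h1 : expMeasure 1 = volume.withDensity (exponentialPDF 1) := rfl
  have h2 : exponentialPDF 1 =
      (Set.Ici 0).indicator fun x => ENNReal.ofReal (Real.exp (-x)) := by
    ext x
    rw [exponentialPDF_eq]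
    by_cases hx : 0 ≤ x
    · simp [hx]
    · simp [hx]
  rw [h1, h2, withDensity_indicator measurableSet_Ici, Measure.restrict_congr_set Ioi_ae_eq_Ici]

lemma ae_pos_expMeasure : ∀ᵐ x ∂expMeasure 1, 0 < x := by
  rw [expMeasure_one_eq]
  exact (withDensity_absolutelyContinuous _ _).ae_le (ae_restrict_mem measurableSet_Ioi)

/-! ### Construction of the walks -/

/-- The uniform distribution on `[0, 1)`. -/
noncomputable def unitUniform : Measure ℝ := volume.restrict (Set.Ico 0 1)

instance : IsProbabilityMeasure unitUniform := ⟨by simp [unitUniform]⟩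

/-- A nearest-neighbour step from `x` at time `t`, as a function of a uniform variable `u`. -/
noncomputable def unifStep {𝕋 : Type*} (μ : 𝕋 → ℤ → ℤ → ℝ) (t : 𝕋) (x : ℤ) (u : ℝ) : ℤ :=
  if u < stepProb μ t x (x + 1) then x + 1
  else if u < stepProb μ t x (x + 1) + stepProb μ t x (x - 1) then x - 1 else x

lemma measurable_unifStep {𝕋 : Type*} [MeasurableSpace 𝕋] {μ : 𝕋 → ℤ → ℤ → ℝ}
    (hμ : ∀ x y, Measurable fun t => stepProb μ t x y) :
    Measurable fun z : (𝕋 × ℝ) × ℤ => unifStep μ z.1.1 z.2 z.1.2 := by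
  refine measurable_from_prod_countable_left fun x => ?_
  have h1 : Measurable fun z : 𝕋 × ℝ => stepProb μ z.1 x (x + 1) :=
    (hμ x (x + 1)).comp measurable_fst
  have h2 : Measurable fun z : 𝕋 × ℝ => stepProb μ z.1 x (x - 1) :=
    (hμ x (x - 1)).comp measurable_fst
  simp only [unifStep]
  exact Measurable.ite (measurableSet_lt measurable_snd h1) measurable_const
    (Measurable.ite (measurableSet_lt measurable_snd (h1.add h2)) measurable_const measurable_const)

lemma unitUniform_unifStep {𝕋 : Type*} {w ℓ : 𝕋 → ℤ → ℝ} (hw : ∀ t x, 0 < w t x)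
    (hℓ : ∀ t x, 0 ≤ ℓ t x) (t : 𝕋) (x y : ℤ) :
    unitUniform {u | unifStep (nnCond w ℓ) t x u = y} =
      ENNReal.ofReal (stepProb (nnCond w ℓ) t x y) := by
  have hp := stepProb_nnCond_nonneg t x hw hℓ
  have hsum := stepProb_nnCond_add t x hw hℓ
  have h1 := hp (x + 1)
  have h2 := hp (x - 1)
  have h3 := hp x
  have hm : Measurable (unifStep (nnCond w ℓ) t x) :=
    Measurable.ite measurableSet_Iio measurable_const
      (Measurable.ite measurableSet_Iio measurable_const measurable_const)
  have hms : MeasurableSet {u | unifStep (nnCond w ℓ) t x u = y} := hm (measurableSet_singleton y)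
  rw [unitUniform, Measure.restrict_apply hms]
  by_cases hr : y = x + 1
  · subst hr
    have : {u | unifStep (nnCond w ℓ) t x u = x + 1} ∩ Set.Ico 0 1 =
        Set.Ico 0 (stepProb (nnCond w ℓ) t x (x + 1)) := by
      ext u
      simp only [unifStep, Set.mem_inter_iff, Set.mem_ofPred_eq, Set.mem_Ico]
      split_ifs with c1 c2
      · exact ⟨fun h => ⟨h.2.1, c1⟩, fun h => ⟨rfl, h.1, by linarith⟩⟩
      · exact ⟨fun h => by omega, fun h => absurd h.2 c1⟩
      · exact ⟨fun h => by omega, fun h => absurd h.2 c1⟩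
    rw [this, Real.volume_Ico, sub_zero]
  by_cases hl : y = x - 1
  · subst hl
    have : {u | unifStep (nnCond w ℓ) t x u = x - 1} ∩ Set.Ico 0 1 =
        Set.Ico (stepProb (nnCond w ℓ) t x (x + 1))
          (stepProb (nnCond w ℓ) t x (x + 1) + stepProb (nnCond w ℓ) t x (x - 1)) := by
      ext u
      simp only [unifStep, Set.mem_inter_iff, Set.mem_ofPred_eq, Set.mem_Ico]
      split_ifs with c1 c2
      · exact ⟨fun h => by omega, fun h => by linarith [h.1]⟩
      · exact ⟨fun h => ⟨not_lt.1 c1, c2⟩, fun h => ⟨rfl, by linarith, by linarith⟩⟩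
      · exact ⟨fun h => by omega, fun h => absurd h.2 c2⟩
    rw [this, Real.volume_Ico, add_sub_cancel_left]
  by_cases hs : y = x
  · subst hs
    have : {u | unifStep (nnCond w ℓ) t y u = y} ∩ Set.Ico 0 1 =
        Set.Ico (stepProb (nnCond w ℓ) t y (y + 1) + stepProb (nnCond w ℓ) t y (y - 1)) 1 := by
      ext u
      simp only [unifStep, Set.mem_inter_iff, Set.mem_ofPred_eq, Set.mem_Ico]
      split_ifs with c1 c2
      · exact ⟨fun h => by omega, fun h => by linarith [h.1]⟩
      · exact ⟨fun h => by omega, fun h => by linarith [h.1]⟩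
      · exact ⟨fun h => ⟨not_lt.1 c2, h.2.2⟩, fun h => ⟨rfl, by linarith, h.2⟩⟩
    rw [this, Real.volume_Ico]
    congr 1
    linarith
  · have : {u | unifStep (nnCond w ℓ) t x u = y} ∩ Set.Ico 0 1 = ∅ := by
      ext u
      simp only [unifStep, Set.mem_inter_iff, Set.mem_ofPred_eq, Set.mem_Ico, Set.mem_empty_iff_false,
        iff_false]
      split_ifs <;> omega
    rw [this, stepProb_nnCond_eq_zero w ℓ t x hr hl hs]
    simp

/-- The laws of the noise variables: at even indices the holding times, at odd indices the uniform
variables that determine the steps. -/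
noncomputable def noiseLaw (i : ℕ) : Measure ℝ := if Even i then expMeasure 1 else unitUniform

instance (i : ℕ) : IsProbabilityMeasure (noiseLaw i) := by
  unfold noiseLaw
  split_ifs
  · exact isProbabilityMeasure_expMeasure one_pos
  · infer_instance

/-- The law of the independent noise sequence. -/
noncomputable def noise : Measure (ℕ → ℝ) := Measure.infinitePi noiseLaw

instance : IsProbabilityMeasure noise := by unfold noise; infer_instance

lemma noise_map_eval (i : ℕ) : noise.map (fun ω => ω i) = noiseLaw i :=
  Measure.infinitePi_map_eval noiseLaw i

/-- The σ-algebra generated by the first `N` noise variables. -/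
@[reducible]
def noisePast (N : ℕ) : MeasurableSpace (ℕ → ℝ) :=
  MeasurableSpace.comap (Finset.range N).restrict inferInstance

lemma measurable_eval_noisePast {i N : ℕ} (hi : i < N) :
    Measurable[noisePast N] fun ω : ℕ → ℝ => ω i := by
  have : (fun ω : ℕ → ℝ => ω i) =
      (fun z : (i : Finset.range N) → ℝ => z ⟨i, Finset.mem_range.2 hi⟩) ∘
        (Finset.range N).restrict := rfl
  rw [this]
  exact (measurable_pi_apply _).comp (comap_measurable _)

lemma noisePast_le (N : ℕ) : noisePast N ≤ MeasurableSpace.pi :=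
  (Finset.measurable_restrict _).comap_le

lemma noisePast_mono {N N' : ℕ} (h : N ≤ N') : noisePast N ≤ noisePast N' := by
  have hm : Measurable[noisePast N'] ((Finset.range N).restrict (π := fun _ => ℝ)) :=
    @measurable_pi_lambda _ _ _ (noisePast N') _ _ fun i =>
      measurable_eval_noisePast ((Finset.mem_range.1 i.2).trans_le h)
  exact hm.comap_le

lemma indepFun_noisePast {α : Type*} [MeasurableSpace α] {N : ℕ} {W : (ℕ → ℝ) → α}
    (hW : Measurable[noisePast N] W) : IndepFun W (fun ω => ω N) noise := by
  have h := (iIndepFun_infinitePi (P := noiseLaw) (X := fun _ x => x)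
    fun _ => measurable_id).indepFun_finset (Finset.range N) {N} (by simp) (by fun_prop)
  have h2 := h.comp measurable_id
    (measurable_pi_apply (⟨N, Finset.mem_singleton_self N⟩ : ({N} : Finset ℕ)))
  rw [IndepFun_iff_Indep] at h2 ⊢
  exact indep_of_indep_of_le_left h2 hW.comap_le

/-- The conditional law, given `W`, of a function of `W` and an independent uniform variable. -/
lemma measure_step {Ω α V : Type*} [MeasurableSpace Ω] [MeasurableSpace α] [MeasurableSpace V]
    [MeasurableSingletonClass V] {P : Measure Ω} [IsProbabilityMeasure P] {W : Ω → α} {U : Ω → ℝ}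
    (hW : Measurable W) (hU : Measurable U) (hind : IndepFun W U P) (hlaw : P.map U = unitUniform)
    {f : α × ℝ → V} (hf : Measurable f) {B : Set α} (hB : MeasurableSet B) (y : V) :
    P {ω | W ω ∈ B ∧ f (W ω, U ω) = y} =
      ∫⁻ ω in {ω | W ω ∈ B}, unitUniform {u | f (W ω, u) = y} ∂P := by
  have hS : MeasurableSet {z : α × ℝ | z.1 ∈ B ∧ f z = y} :=
    (measurable_fst hB).inter (hf (measurableSet_singleton y))
  have hy : Measurable fun a => unitUniform {u | f (a, u) = y} :=
    measurable_measure_prodMk_left (hf (measurableSet_singleton y))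
  have e1 : P {ω | W ω ∈ B ∧ f (W ω, U ω) = y} =
      (P.map fun ω => (W ω, U ω)) {z : α × ℝ | z.1 ∈ B ∧ f z = y} := by
    rw [Measure.map_apply (hW.prodMk hU) hS]; rfl
  have hWp := Measure.isProbabilityMeasure_map (μ := P) hW.aemeasurable
  rw [e1, (indepFun_iff_map_prod_eq_prod_map_map hW.aemeasurable hU.aemeasurable).1 hind, hlaw,
    Measure.prod_apply hS]
  have e2 : ∫⁻ ω in {ω | W ω ∈ B}, unitUniform {u | f (W ω, u) = y} ∂P =
      ∫⁻ a in B, unitUniform {u | f (a, u) = y} ∂(P.map W) :=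
    (setLIntegral_map hB hy hW).symm
  rw [e2, ← lintegral_indicator hB]
  refine lintegral_congr fun a => ?_
  by_cases ha : a ∈ B
  · simp [ha]
  · simp [ha]

/-- The discrete time walk driven by the noise. -/
noncomputable def discreteWalk (μ : ℕ → ℤ → ℤ → ℝ) (x₀ : ℤ) : ℕ → (ℕ → ℝ) → ℤ
  | 0, _ => x₀
  | n + 1, ω => unifStep μ n (discreteWalk μ x₀ n ω) (ω (2 * n + 1))

lemma measurable_discreteWalk (μ : ℕ → ℤ → ℤ → ℝ) (x₀ : ℤ) (n : ℕ) :
    Measurable[noisePast (2 * n)] (discreteWalk μ x₀ n) := by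
  induction n with
  | zero => exact @measurable_const _ _ _ (noisePast _) x₀
  | succ n ih =>
    have h1 : Measurable[noisePast (2 * (n + 1))] (discreteWalk μ x₀ n) :=
      ih.mono (noisePast_mono (by omega)) le_rfl
    have h2 : Measurable[noisePast (2 * (n + 1))] fun ω : ℕ → ℝ => ω (2 * n + 1) :=
      measurable_eval_noisePast (by omega)
    have h3 := measurable_unifStep (μ := μ) fun x y => measurable_of_countable _
    let _ := noisePast (2 * (n + 1))
    exact h3.comp ((measurable_const (a := n).prodMk h2).prodMk h1)

lemma isDiscreteWalk_discreteWalk {w ℓ : ℕ → ℤ → ℝ} (hw : ∀ t x, 0 < w t x)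
    (hℓ : ∀ t x, 0 ≤ ℓ t x) (x₀ : ℤ) :
    IsDiscreteWalk (nnCond w ℓ) noise (discreteWalk (nnCond w ℓ) x₀) := by
  set X := discreteWalk (nnCond w ℓ) x₀ with hX
  have hmeas : ∀ n, Measurable (X n) := fun n =>
    (measurable_discreteWalk (nnCond w ℓ) x₀ n).mono (noisePast_le _) le_rfl
  refine ⟨hmeas, fun n x => ?_⟩
  have hWp : Measurable[noisePast (2 * n + 1)] fun ω => fun i : Fin (n + 1) => X i ω :=
    @measurable_pi_lambda _ _ _ (noisePast _) _ _ fun i =>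
      (measurable_discreteWalk (nnCond w ℓ) x₀ i).mono (noisePast_mono (by omega)) le_rfl
  have hW : Measurable fun ω => fun i : Fin (n + 1) => X i ω :=
    measurable_pi_lambda _ fun i => hmeas i
  have hf : Measurable fun z : (Fin (n + 1) → ℤ) × ℝ =>
      unifStep (nnCond w ℓ) n (z.1 (Fin.last n)) z.2 := by
    have h3 := measurable_unifStep (μ := nnCond w ℓ) fun x y => measurable_of_countable _
    exact h3.comp ((measurable_const (a := n).prodMk measurable_snd).prodMk
      ((measurable_pi_apply _).comp measurable_fst))
  have hlaw : noise.map (fun ω => ω (2 * n + 1)) = unitUniform := by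
    rw [noise_map_eval, noiseLaw, if_neg (by simp)]
  have h := measure_step hW (measurable_pi_apply _) (indepFun_noisePast hWp) hlaw hf
    (measurableSet_singleton fun i : Fin (n + 1) => x i) (x (n + 1))
  have s1 : {ω | (fun i : Fin (n + 1) => X i ω) ∈ ({fun i : Fin (n + 1) => x i} : Set _)} =
      {ω | ∀ i ≤ n, X i ω = x i} := by
    ext ω
    simp only [Set.mem_singleton_iff, Set.mem_ofPred_eq, funext_iff]
    exact ⟨fun h i hi => h ⟨i, Nat.lt_succ_iff.2 hi⟩, fun h i => h i (Nat.lt_succ_iff.1 i.2)⟩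
  have s2 : {ω | ∀ i ≤ n + 1, X i ω = x i} =
      {ω | (fun i : Fin (n + 1) => X i ω) ∈ ({fun i : Fin (n + 1) => x i} : Set _) ∧
        unifStep (nnCond w ℓ) n (X (Fin.last n) ω) (ω (2 * n + 1)) = x (n + 1)} := by
    ext ω
    have := Set.ext_iff.1 s1 ω
    simp only [Set.mem_ofPred_eq] at this ⊢
    rw [this]
    constructor
    · exact fun h => ⟨fun i hi => h i (by omega), h (n + 1) le_rfl⟩
    · rintro ⟨h1, h2⟩ i hi
      rcases Nat.le_succ_iff.1 hi with hi | rfl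
      · exact h1 i hi
      · exact h2
  rw [s2, h, ← s1]
  have hS : MeasurableSet
      {ω | (fun i : Fin (n + 1) => X i ω) ∈ ({fun i : Fin (n + 1) => x i} : Set _)} :=
    hW (measurableSet_singleton _)
  rw [setLIntegral_congr_fun (g := fun _ => ENNReal.ofReal (stepProb (nnCond w ℓ) n (x n)
    (x (n + 1)))) hS, setLIntegral_const, mul_comm]
  intro ω hω
  have : X n ω = x n := congrFun (show (fun i : Fin (n + 1) => X i ω) = fun i : Fin (n + 1) => x i from hω)
    (Fin.last n)
  simp only
  rw [← this]
  exact unitUniform_unifStep hw hℓ n (X n ω) _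

section CSRWConstruction

/-- The holding times. -/
noncomputable def noiseHold (n : ℕ) (ω : ℕ → ℝ) : ℝ≥0 := (ω (2 * n)).toNNReal

/-- The successive positions of the CSRW driven by the noise. -/
noncomputable def noiseJump (μ : ℝ≥0 → ℤ → ℤ → ℝ) (x₀ : ℤ) : ℕ → (ℕ → ℝ) → ℤ
  | 0, _ => x₀
  | n + 1, ω => unifStep μ (jumpTime noiseHold (n + 1) ω) (noiseJump μ x₀ n ω) (ω (2 * n + 1))

open scoped Classical in
/-- The step path of the CSRW. The second alternative is relevant only on the null event that the
jump times are bounded. -/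
noncomputable def noisePath (μ : ℝ≥0 → ℤ → ℤ → ℝ) (x₀ : ℤ) (t : ℝ≥0) (ω : ℕ → ℝ) : ℤ :=
  noiseJump μ x₀ (Nat.find (p := fun n => t < jumpTime noiseHold (n + 1) ω ∨
    ∀ m, jumpTime noiseHold (m + 1) ω ≤ t) (by
      by_cases h : ∃ n, t < jumpTime noiseHold (n + 1) ω
      · exact h.imp fun n hn => Or.inl hn
      · exact ⟨0, Or.inr fun m => not_lt.1 fun hm => h ⟨m, hm⟩⟩)) ω

lemma measurable_noiseHold {n N : ℕ} (h : 2 * n < N) : Measurable[noisePast N] (noiseHold n) :=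
  measurable_real_toNNReal.comp (measurable_eval_noisePast h)

lemma measurable_jumpTime_noiseHold {n N : ℕ} (h : 2 * n ≤ N + 1) :
    Measurable[noisePast N] (jumpTime noiseHold n) := by
  let _ := noisePast N
  have : jumpTime noiseHold n = fun ω => ∑ k ∈ Finset.range n, noiseHold k ω := rfl
  rw [this]
  exact Finset.measurable_fun_sum _ fun k hk =>
    measurable_noiseHold (by have := Finset.mem_range.1 hk; omega)

lemma measurable_noiseJump {μ : ℝ≥0 → ℤ → ℤ → ℝ}
    (hμ : ∀ x y, Measurable fun t => stepProb μ t x y) (x₀ : ℤ) (n : ℕ) : Measurable[noisePast (2 * n)] (noiseJump μ x₀ n) := by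
  induction n with
  | zero => exact @measurable_const _ _ _ (noisePast _) x₀
  | succ n ih =>
    have h1 : Measurable[noisePast (2 * (n + 1))] (noiseJump μ x₀ n) :=
      ih.mono (noisePast_mono (by omega)) le_rfl
    have h2 : Measurable[noisePast (2 * (n + 1))] fun ω : ℕ → ℝ => ω (2 * n + 1) :=
      measurable_eval_noisePast (by omega)
    have h3 : Measurable[noisePast (2 * (n + 1))] (jumpTime noiseHold (n + 1)) :=
      measurable_jumpTime_noiseHold (by omega)
    let _ := noisePast (2 * (n + 1))
    exact (measurable_unifStep hμ).comp ((h3.prodMk h2).prodMk h1)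

end CSRWConstruction

lemma jumpTime_mono {Ω : Type*} (H : ℕ → Ω → ℝ≥0) (ω : Ω) : Monotone fun n => jumpTime H n ω :=
  monotone_nat_of_le_succ fun n => by simp [jumpTime, Finset.sum_range_succ]

lemma isCSRWWith_noise {w ℓ : ℝ≥0 → ℤ → ℝ} (hw : ∀ t x, 0 < w t x) (hℓ : ∀ t x, 0 ≤ ℓ t x)
    (hμ : ∀ x y, Measurable fun t => stepProb (nnCond w ℓ) t x y) (x₀ : ℤ) :
    IsCSRWWith (nnCond w ℓ) noise (noisePath (nnCond w ℓ) x₀) (noiseJump (nnCond w ℓ) x₀)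
      noiseHold := by
  have hJ : ∀ n, Measurable (noiseJump (nnCond w ℓ) x₀ n) := fun n =>
    (measurable_noiseJump hμ x₀ n).mono (noisePast_le _) le_rfl
  have hH : ∀ n, Measurable (noiseHold n) := fun n =>
    (measurable_noiseHold (Nat.lt_succ_self _)).mono (noisePast_le _) le_rfl
  have hT : ∀ n, Measurable (jumpTime noiseHold n) := fun n =>
    (measurable_jumpTime_noiseHold (N := 2 * n) (by omega)).mono (noisePast_le _) le_rfl
  refine ⟨fun t => ?_, hJ, hH, fun n => ?_, fun n => ?_, fun n y B hB => ?_, ?_⟩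
  · classical
    unfold noisePath
    refine Measurable.find hJ (fun n => ?_) _
    refine (measurableSet_lt measurable_const (hT (n + 1))).union ?_
    have : {ω : ℕ → ℝ | ∀ m, jumpTime noiseHold (m + 1) ω ≤ t} =
        ⋂ m, {ω | jumpTime noiseHold (m + 1) ω ≤ t} := by ext ω; simp
    change MeasurableSet {ω : ℕ → ℝ | ∀ m, jumpTime noiseHold (m + 1) ω ≤ t}
    rw [this]
    exact MeasurableSet.iInter fun m => measurableSet_le (hT (m + 1)) measurable_const
  · have e1 : (fun ω : ℕ → ℝ => (noiseHold n ω : ℝ)) = (fun x : ℝ => (x.toNNReal : ℝ)) ∘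
      fun ω : ℕ → ℝ => ω (2 * n) := rfl
    rw [e1, ← Measure.map_map (g := fun x : ℝ => (x.toNNReal : ℝ)) (by fun_prop)
      (measurable_pi_apply (X := fun _ : ℕ => ℝ) (2 * n)), noise_map_eval, noiseLaw,
      if_pos (by simp)]
    have : (fun x : ℝ => (x.toNNReal : ℝ)) =ᵐ[expMeasure 1] id :=
      ae_pos_expMeasure.mono fun x hx => Real.coe_toNNReal x hx.le
    rw [Measure.map_congr this, Measure.map_id]
  · have hW : Measurable[noisePast (2 * n)] fun ω =>
        ((fun i : Fin (n + 1) => noiseJump (nnCond w ℓ) x₀ i ω),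
          (fun i : Fin n => noiseHold i ω)) := by
      let _ := noisePast (2 * n)
      exact (measurable_pi_lambda _ fun i : Fin (n + 1) => (measurable_noiseJump hμ x₀ i).mono
        (noisePast_mono (by have := i.2; omega)) le_rfl).prodMk
        (measurable_pi_lambda _ fun i : Fin n =>
          measurable_noiseHold (n := i) (by have := i.2; omega))
    exact ((indepFun_noisePast hW).comp measurable_id measurable_real_toNNReal).symm
  · set W : (ℕ → ℝ) → (Fin (n + 1) → ℤ) × (Fin (n + 1) → ℝ≥0) := fun ω =>
        ((fun i : Fin (n + 1) => noiseJump (nnCond w ℓ) x₀ i ω),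
          (fun i : Fin (n + 1) => noiseHold i ω)) with hWdef
    have hWp : Measurable[noisePast (2 * n + 1)] W := by
      let _ := noisePast (2 * n + 1)
      exact (measurable_pi_lambda _ fun i : Fin (n + 1) => (measurable_noiseJump hμ x₀ i).mono
        (noisePast_mono (by have := i.2; omega)) le_rfl).prodMk
        (measurable_pi_lambda _ fun i : Fin (n + 1) =>
          measurable_noiseHold (n := i) (by have := i.2; omega))
    have hf : Measurable fun z : ((Fin (n + 1) → ℤ) × (Fin (n + 1) → ℝ≥0)) × ℝ =>
        unifStep (nnCond w ℓ) (∑ i, z.1.2 i) (z.1.1 (Fin.last n)) z.2 := by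
      have hs : Measurable fun z : ((Fin (n + 1) → ℤ) × (Fin (n + 1) → ℝ≥0)) × ℝ =>
          ∑ i, z.1.2 i := Finset.measurable_fun_sum _ fun i _ => by fun_prop
      have hj : Measurable fun z : ((Fin (n + 1) → ℤ) × (Fin (n + 1) → ℝ≥0)) × ℝ =>
          z.1.1 (Fin.last n) := by fun_prop
      exact (measurable_unifStep hμ).comp ((hs.prodMk measurable_snd).prodMk hj)
    have hlaw : noise.map (fun ω => ω (2 * n + 1)) = unitUniform := by
      rw [noise_map_eval, noiseLaw, if_neg (by simp)]
    have hsum : ∀ ω, jumpTime noiseHold (n + 1) ω = ∑ i : Fin (n + 1), noiseHold i ω := fun ω =>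
      Finset.sum_range _
    have h := measure_step (hWp.mono (noisePast_le _) le_rfl) (measurable_pi_apply _)
      (indepFun_noisePast hWp) hlaw hf hB y
    simp only [hWdef, ← hsum, Fin.val_last] at h
    refine h.trans (lintegral_congr fun ω => ?_)
    exact unitUniform_unifStep hw hℓ _ _ _
  · refine ae_of_all _ fun ω n t h1 h2 => ?_
    classical
    unfold noisePath
    congr 1
    rw [Nat.find_eq_iff]
    refine ⟨Or.inl h2, fun m hm => ?_⟩
    rintro (h3 | h3)
    · exact absurd (h3.trans_le (jumpTime_mono noiseHold ω (Nat.succ_le_of_lt hm))) (not_lt.2 h1)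
    · exact absurd (h3 n) (not_le.2 h2)

/-! ### Means under the exponential distribution -/

lemma integral_expMeasure_one (f : ℝ → ℝ) :
    ∫ x, f x ∂expMeasure 1 = ∫ x in Set.Ioi 0, Real.exp (-x) * f x := by
  rw [expMeasure_one_eq, integral_withDensity_eq_integral_toReal_smul (by fun_prop)
    (ae_of_all _ fun x => ENNReal.ofReal_lt_top)]
  refine integral_congr_ae (ae_of_all _ fun x => ?_)
  simp [ENNReal.toReal_ofReal (Real.exp_pos _).le]

lemma integrable_expMeasure_one_iff {f : ℝ → ℝ} :
    Integrable f (expMeasure 1) ↔ IntegrableOn (fun x => Real.exp (-x) * f x) (Set.Ioi 0) := by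
  rw [expMeasure_one_eq, integrable_withDensity_iff_integrable_smul' (by fun_prop)
    (ae_of_all _ fun x => ENNReal.ofReal_lt_top), IntegrableOn]
  refine integrable_congr (ae_of_all _ fun x => ?_)
  simp [ENNReal.toReal_ofReal (Real.exp_pos _).le]

lemma integrable_exp_half : Integrable (fun h : ℝ => Real.exp (h / 2)) (expMeasure 1) := by
  rw [integrable_expMeasure_one_iff]
  refine (integrableOn_exp_mul_Ioi (a := -(1 / 2)) (by norm_num) 0).congr_fun (fun x _ => ?_)
    measurableSet_Ioi
  simp only
  rw [← Real.exp_add]; congr 1; ring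

/-- The resolvent identity: if `m = g - g'` (with the right derivative `g'`), then `g 0` is the mean
of `m` at an independent exponential time. -/
lemma integral_expMeasure_of_hasDeriv_right {g m : ℝ → ℝ} {K : ℝ} (hK : 0 ≤ K)
    (hg : ContinuousOn g (Set.Ici 0))
    (hd : ∀ h, 0 ≤ h → HasDerivWithinAt g (g h - m h) (Set.Ioi h) h) (hm : Measurable m)
    (hgb : ∀ h, 0 ≤ h → |g h| ≤ K * (1 + h)) (hmb : ∀ h, 0 ≤ h → |m h| ≤ K * (1 + h)) :
    Integrable m (expMeasure 1) ∧ ∫ h, m h ∂expMeasure 1 = g 0 := by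
  have hlin : ∀ h : ℝ, 0 ≤ h → 1 + h ≤ 2 * Real.exp (h / 2) := fun h hh => by
    linarith [Real.add_one_le_exp (h / 2)]
  have hint : Integrable m (expMeasure 1) := by
    refine (integrable_exp_half.const_mul (2 * K)).mono' hm.aestronglyMeasurable ?_
    filter_upwards [ae_pos_expMeasure] with h hh
    rw [Real.norm_eq_abs]
    have := mul_le_mul_of_nonneg_left (hlin h hh.le) hK
    linarith [hmb h hh.le]
  refine ⟨hint, ?_⟩
  rw [integral_expMeasure_one]
  have hint' := integrable_expMeasure_one_iff.1 hint
  have h1 := intervalIntegral_tendsto_integral_Ioi 0 hint' tendsto_id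
  have h2 : ∀ R : ℝ, 0 ≤ R → ∫ x in (0 : ℝ)..R, Real.exp (-x) * m x =
      g 0 - Real.exp (-R) * g R := by
    intro R hR
    have := intervalIntegral.integral_eq_sub_of_hasDeriv_right_of_le
      (f := fun x => -(Real.exp (-x) * g x)) (f' := fun x => Real.exp (-x) * m x) hR ?_ ?_ ?_
    · rw [this]; simp; ring
    · exact ((Real.continuous_exp.comp continuous_neg).continuousOn.mul
        (hg.mono Set.Icc_subset_Ici_self)).neg
    · intro x hx
      have e1 : HasDerivWithinAt (fun x : ℝ => Real.exp (-x)) (-Real.exp (-x)) (Set.Ioi x) x := by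
        have := ((hasDerivAt_neg x).exp).hasDerivWithinAt (s := Set.Ioi x)
        simpa using this
      refine ((e1.mul (hd x hx.1.le)).neg).congr_deriv ?_
      ring
    · rw [intervalIntegrable_iff_integrableOn_Ioc_of_le hR]
      exact hint'.mono_set Set.Ioc_subset_Ioi_self
  have h3 : Tendsto (fun R : ℝ => g 0 - Real.exp (-R) * g R) atTop (𝓝 (g 0 - 0)) := by
    refine tendsto_const_nhds.sub ?_
    have h4 : Tendsto (fun R : ℝ => 2 * K * Real.exp (-(R / 2))) atTop (𝓝 (2 * K * 0)) :=
      (Real.tendsto_exp_atBot.comp (tendsto_neg_atTop_atBot.comp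
        (tendsto_id.atTop_div_const two_pos))).const_mul _
    rw [mul_zero] at h4
    refine squeeze_zero_norm' ?_ h4
    filter_upwards [eventually_ge_atTop 0] with R hR
    rw [Real.norm_eq_abs, abs_mul, abs_of_pos (Real.exp_pos _)]
    calc Real.exp (-R) * |g R| ≤ Real.exp (-R) * (K * (2 * Real.exp (R / 2))) :=
          mul_le_mul_of_nonneg_left ((hgb R hR).trans (mul_le_mul_of_nonneg_left (hlin R hR) hK))
            (Real.exp_pos _).le
      _ = 2 * K * (Real.exp (-R) * Real.exp (R / 2)) := by ring
      _ = 2 * K * Real.exp (-(R / 2)) := by rw [← Real.exp_add]; congr 2; ring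
  rw [sub_zero] at h3
  refine tendsto_nhds_unique h1 (h3.congr' ?_)
  filter_upwards [eventually_ge_atTop 0] with R hR
  exact (h2 R hR).symm

lemma exp_le_one_add_add_sq_mul_exp_abs (z : ℝ) :
    Real.exp z ≤ 1 + z + z ^ 2 * Real.exp |z| := by
  have h1 : 1 ≤ Real.exp |z| := Real.one_le_exp (abs_nonneg z)
  have h2 : z ^ 2 ≤ z ^ 2 * Real.exp |z| := le_mul_of_one_le_right (sq_nonneg z) h1
  by_cases hz : |z| ≤ 1
  · linarith [(abs_le.1 (Real.abs_exp_sub_one_sub_id_le hz)).2]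
  · rcases lt_abs.1 (not_le.1 hz) with h | h
    · rw [abs_of_pos (by linarith)] at h2 ⊢
      have : Real.exp z ≤ z ^ 2 * Real.exp z :=
        le_mul_of_one_le_left (Real.exp_pos z).le (by nlinarith)
      linarith
    · have : Real.exp z ≤ 1 := Real.exp_le_one_iff.2 (by linarith)
      nlinarith

/-- Second-order bound for the exponential of `θ D` when `D` grows at most linearly in `h`. -/
lemma exp_mul_le_of_abs_le {K θ D h : ℝ} (hK : 0 < K) (hθ : |θ| ≤ 1 / (4 * K)) (hh : 0 ≤ h)
    (hD : |D| ≤ K * (1 + h)) :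
    Real.exp (θ * D) ≤
      1 + θ * D + θ ^ 2 * (32 * K ^ 2 * Real.exp (1 / 2)) * Real.exp (h / 2) := by
  refine (exp_le_one_add_add_sq_mul_exp_abs _).trans (add_le_add_right ?_ _)
  have h1 : |θ * D| ≤ (1 + h) / 4 := by
    rw [abs_mul]
    calc |θ| * |D| ≤ 1 / (4 * K) * (K * (1 + h)) :=
          mul_le_mul hθ hD (abs_nonneg _) (by positivity)
      _ = (1 + h) / 4 := by field_simp
  have h2 : D ^ 2 ≤ K ^ 2 * (1 + h) ^ 2 := by
    rw [← mul_pow, ← sq_abs D]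
    exact pow_le_pow_left₀ (abs_nonneg _) hD 2
  have h3 : (1 + h) ^ 2 ≤ 32 * Real.exp ((1 + h) / 4) := by
    have := Real.quadratic_le_exp_of_nonneg (show 0 ≤ (1 + h) / 4 by positivity)
    nlinarith
  have h4 : Real.exp |θ * D| ≤ Real.exp ((1 + h) / 4) := Real.exp_le_exp.2 h1
  have h5 : Real.exp ((1 + h) / 4) * Real.exp ((1 + h) / 4) =
      Real.exp (1 / 2) * Real.exp (h / 2) := by
    rw [← Real.exp_add, ← Real.exp_add]; congr 1; ring
  calc (θ * D) ^ 2 * Real.exp |θ * D|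
      ≤ (θ ^ 2 * (K ^ 2 * (32 * Real.exp ((1 + h) / 4)))) * Real.exp ((1 + h) / 4) := by
        refine mul_le_mul ?_ h4 (Real.exp_pos _).le (by positivity)
        rw [mul_pow]
        refine mul_le_mul_of_nonneg_left (h2.trans ?_) (sq_nonneg _)
        exact mul_le_mul_of_nonneg_left h3 (sq_nonneg _)
    _ = 32 * θ ^ 2 * K ^ 2 * (Real.exp ((1 + h) / 4) * Real.exp ((1 + h) / 4)) := by ring
    _ = _ := by rw [h5]; ring

/-! ### The constant speed random walk -/

section CSRW

variable {Ω : Type*} [MeasurableSpace Ω] {P : Measure Ω} {Y : ℝ≥0 → Ω → ℤ}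
  {J : ℕ → Ω → ℤ} {H : ℕ → Ω → ℝ≥0} {μ : ℝ≥0 → ℤ → ℤ → ℝ}

lemma jumpTime_succ {Ω : Type*} (H : ℕ → Ω → ℝ≥0) (n : ℕ) (ω : Ω) :
    jumpTime H (n + 1) ω = jumpTime H n ω + H n ω := Finset.sum_range_succ _ _

lemma IsCSRWWith.measurable_jumpTime (hX : IsCSRWWith μ P Y J H) (n : ℕ) :
    Measurable (jumpTime H n) :=
  Finset.measurable_fun_sum _ fun k _ => hX.measurable_hold k

lemma IsCSRWWith.map_hold (hX : IsCSRWWith μ P Y J H) (n : ℕ) :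
    P.map (H n) = (expMeasure 1).map Real.toNNReal := by
  rw [← hX.hold_law n, Measure.map_map (f := fun ω => (H n ω : ℝ)) measurable_real_toNNReal
    (measurable_coe_nnreal_real.comp (hX.measurable_hold n))]
  congr 1
  ext ω
  simp

lemma IsCSRWWith.ae_zero (hX : IsCSRWWith μ P Y J H) : ∀ᵐ ω ∂P, Y 0 ω = J 0 ω := by
  have hpos : ∀ᵐ ω ∂P, 0 < (H 0 ω : ℝ) := by
    have h := ae_pos_expMeasure
    rw [← hX.hold_law 0] at h
    exact ae_of_ae_map (measurable_coe_nnreal_real.comp (hX.measurable_hold 0)).aemeasurable h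
  filter_upwards [hX.path, hpos] with ω h1 h2
  refine h1 0 0 (by simp [jumpTime]) ?_
  rw [jumpTime_succ]
  simpa [jumpTime] using h2

variable [IsProbabilityMeasure P]

/-- The pairs (jump time, position) form a Markov chain, in integrated form. -/
lemma IsCSRWWith.lintegral_succ (hX : IsCSRWWith μ P Y J H)
    (hμ : ∀ x y, Measurable fun t => stepProb μ t x y) (n : ℕ) {G : ℝ≥0 → ℤ → ℝ≥0∞}
    (hG : ∀ y, Measurable fun t => G t y) :
    ∫⁻ ω, G (jumpTime H (n + 1) ω) (J (n + 1) ω) ∂P =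
      ∫⁻ ω, ∫⁻ h, ∑' y, ENNReal.ofReal (stepProb μ (jumpTime H n ω + h.toNNReal) (J n ω) y) *
        G (jumpTime H n ω + h.toNNReal) y ∂expMeasure 1 ∂P := by
  have hJ := hX.measurable_pos
  have hT := hX.measurable_jumpTime
  set W : Ω → (Fin (n + 1) → ℤ) × (Fin (n + 1) → ℝ≥0) := fun ω =>
    ((fun i : Fin (n + 1) => J i ω), (fun i : Fin (n + 1) => H i ω)) with hWdef
  have hW : Measurable W :=
    (measurable_pi_lambda (fun ω (i : Fin (n + 1)) => J i ω) fun i => hJ i).prodMk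
      (measurable_pi_lambda (fun ω (i : Fin (n + 1)) => H i ω) fun i => hX.measurable_hold i)
  have hμ' : ∀ y, Measurable fun z : ℝ≥0 × ℤ => ENNReal.ofReal (stepProb μ z.1 z.2 y) := fun y =>
    ENNReal.measurable_ofReal.comp (measurable_from_prod_countable_left fun x => hμ x y)
  have hp : ∀ y, Measurable fun ω =>
      ENNReal.ofReal (stepProb μ (jumpTime H (n + 1) ω) (J n ω) y) := fun y =>
    (hμ' y).comp ((hT (n + 1)).prodMk (hJ n))
  have hmap : ∀ y, (P.restrict {ω | J (n + 1) ω = y}).map W =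
      (P.withDensity fun ω =>
        ENNReal.ofReal (stepProb μ (jumpTime H (n + 1) ω) (J n ω) y)).map W := by
    intro y
    ext B hB
    rw [Measure.map_apply hW hB, Measure.map_apply hW hB, Measure.restrict_apply (hW hB),
      withDensity_apply _ (hW hB)]
    exact hX.jump n y B hB
  -- integrate out the jump
  have e1 : ∀ y, ∫⁻ ω in {ω | J (n + 1) ω = y}, G (jumpTime H (n + 1) ω) y ∂P =
      ∫⁻ ω, ENNReal.ofReal (stepProb μ (jumpTime H (n + 1) ω) (J n ω) y) *
        G (jumpTime H (n + 1) ω) y ∂P := by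
    intro y
    have hs : Measurable fun z : (Fin (n + 1) → ℤ) × (Fin (n + 1) → ℝ≥0) => ∑ i, z.2 i :=
      Finset.measurable_fun_sum _ fun i _ => by fun_prop
    have hGs : Measurable fun z : (Fin (n + 1) → ℤ) × (Fin (n + 1) → ℝ≥0) =>
      G (∑ i, z.2 i) y := (hG y).comp hs
    have hsum : ∀ ω, G (jumpTime H (n + 1) ω) y = G (∑ i, (W ω).2 i) y := fun ω => by
      rw [jumpTime, Finset.sum_range]
    calc _ = ∫⁻ z, G (∑ i, z.2 i) y ∂((P.restrict {ω | J (n + 1) ω = y}).map W) := by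
          rw [lintegral_map hGs hW]; simp only [hsum]
      _ = _ := by
          rw [hmap, lintegral_map hGs hW]
          refine (lintegral_withDensity_eq_lintegral_mul _ (hp y) (hGs.comp hW)).trans
            (lintegral_congr fun ω => ?_)
          simp only [Pi.mul_apply, Function.comp, hsum]
  have e2 : ∫⁻ ω, G (jumpTime H (n + 1) ω) (J (n + 1) ω) ∂P =
      ∫⁻ ω, ∑' y, ENNReal.ofReal (stepProb μ (jumpTime H (n + 1) ω) (J n ω) y) *
        G (jumpTime H (n + 1) ω) y ∂P := by
    have hms : ∀ y, MeasurableSet {ω | J (n + 1) ω = y} := fun y =>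
      hJ (n + 1) (measurableSet_singleton y)
    have hGT : ∀ y, Measurable fun ω => G (jumpTime H (n + 1) ω) y := fun y =>
      (hG y).comp (hT (n + 1))
    have hpG : ∀ y, Measurable fun ω =>
        ENNReal.ofReal (stepProb μ (jumpTime H (n + 1) ω) (J n ω) y) *
          G (jumpTime H (n + 1) ω) y := fun y => (hp y).mul (hGT y)
    rw [lintegral_tsum fun y => (hpG y).aemeasurable]
    simp_rw [← e1, ← lintegral_indicator (hms _)]
    rw [← lintegral_tsum fun y => ((hGT y).indicator (hms y)).aemeasurable]
    refine lintegral_congr fun ω => ?_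
    rw [tsum_eq_single (J (n + 1) ω)]
    · simp
    · intro y hy
      exact Set.indicator_of_notMem (fun h => hy (Eq.symm h)) _
  -- integrate out the holding time
  have hind : IndepFun (H n) (fun ω => (jumpTime H n ω, J n ω)) P := by
    have hφ : Measurable fun z : (Fin (n + 1) → ℤ) × (Fin n → ℝ≥0) =>
        (∑ i, z.2 i, z.1 (Fin.last n)) := by
      have hs : Measurable fun z : (Fin (n + 1) → ℤ) × (Fin n → ℝ≥0) => ∑ i, z.2 i :=
        Finset.measurable_fun_sum _ fun i _ => by fun_prop
      exact hs.prodMk (by fun_prop)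
    have h := (hX.hold_indep n).comp measurable_id hφ
    have e : (fun ω => (jumpTime H n ω, J n ω)) =
        (fun z : (Fin (n + 1) → ℤ) × (Fin n → ℝ≥0) => (∑ i, z.2 i, z.1 (Fin.last n))) ∘
          fun ω => ((fun i : Fin (n + 1) => J i ω), (fun i : Fin n => H i ω)) := by
      ext ω
      · simp [jumpTime, Finset.sum_range]
      · simp
    rw [e]
    exact h
  have hΓ : Measurable fun z : ℝ≥0 × (ℝ≥0 × ℤ) =>
      ∑' y, ENNReal.ofReal (stepProb μ (z.2.1 + z.1) z.2.2 y) * G (z.2.1 + z.1) y := by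
    refine Measurable.tsum fun y => ?_
    refine Measurable.mul ?_ ((hG y).comp (by fun_prop))
    exact (hμ' y).comp (Measurable.prodMk (by fun_prop) (by fun_prop))
  have hTJ : Measurable fun ω => (jumpTime H n ω, J n ω) := (hT n).prodMk (hJ n)
  rw [e2]
  have hHp := Measure.isProbabilityMeasure_map (μ := P) (hX.measurable_hold n).aemeasurable
  have hTp := Measure.isProbabilityMeasure_map (μ := P) hTJ.aemeasurable
  calc _ = ∫⁻ z : ℝ≥0 × (ℝ≥0 × ℤ),
        ∑' y, ENNReal.ofReal (stepProb μ (z.2.1 + z.1) z.2.2 y) * G (z.2.1 + z.1) y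
        ∂(P.map fun ω => (H n ω, (jumpTime H n ω, J n ω))) := by
        rw [lintegral_map hΓ ((hX.measurable_hold n).prodMk hTJ)]
        simp only [jumpTime_succ]
    _ = _ := by
        rw [(indepFun_iff_map_prod_eq_prod_map_map (hX.measurable_hold n).aemeasurable
          hTJ.aemeasurable).1 hind, lintegral_prod_symm' _ hΓ, lintegral_map
          hΓ.lintegral_prod_left' hTJ]
        refine lintegral_congr fun ω => ?_
        rw [hX.map_hold n]
        exact lintegral_map (hΓ.comp measurable_prodMk_right) measurable_real_toNNReal

/-- A space-time harmonic function for the CSRW, evaluated at the jump times, is a martingale. If it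
varies at most linearly in time, its linear deviations are exponentially small. The function may
depend on the number of jumps made so far. -/
lemma IsCSRWWith.expSmall_harmonic {w : ℝ≥0 → ℤ → ℝ} (hw : ∀ t x, 0 < w t x)
    (hμ : ∀ x y, Measurable fun t => stepProb (nnCond w 0) t x y)
    (hX : IsCSRWWith (nnCond w 0) P Y J H) {x₀ : ℤ} (h0 : ∀ᵐ ω ∂P, Y 0 ω = x₀)
    {F : ℕ → ℝ → ℤ → ℝ} {K : ℝ} (hK : 0 < K) (hcont : ∀ n x, Continuous fun t => F n t x)
    (hb : ∀ n t h x y, 0 ≤ h → |y - x| = 1 → |F (n + 1) (t + h) y - F n t x| ≤ K * (1 + h))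
    (hd : ∀ (n : ℕ) (t : ℝ≥0) (x : ℤ), HasDerivWithinAt (fun s => F n s x)
      (F n t x - (stepProb (nnCond w 0) t x (x + 1) * F (n + 1) t (x + 1) +
        stepProb (nnCond w 0) t x (x - 1) * F (n + 1) t (x - 1))) (Set.Ioi t) t) :
    ExpSmall P fun n ω => F n (jumpTime H n ω) (J n ω) - F 0 0 x₀ := by
  set B := 32 * K ^ 2 * Real.exp (1 / 2) with hB
  set I := ∫ h, Real.exp (h / 2) ∂expMeasure 1 with hI
  have hI0 : 0 ≤ I := integral_nonneg fun h => (Real.exp_pos _).le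
  have hFm : ∀ n, Measurable fun z : ℝ × ℤ => F n z.1 z.2 := fun n =>
    measurable_from_prod_countable_left fun x => (hcont n x).measurable
  have hprob := isProbabilityMeasure_expMeasure one_pos
  refine expSmall_of_exp_step (θ₀ := 1 / (4 * K)) (C := B * I) (fun n => ?_) ?_ (by positivity)
    (by positivity) fun θ hθ n => ?_
  · exact ((hFm n).comp ((measurable_coe_nnreal_real.comp (hX.measurable_jumpTime n)).prodMk
      (hX.measurable_pos n))).sub_const _
  · filter_upwards [h0, hX.ae_zero] with ω h1 h2
    rw [← h2, h1]; simp [jumpTime]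
  rw [hX.lintegral_succ hμ n
    (G := fun t y => ENNReal.ofReal (Real.exp (θ * (F (n + 1) t y - F 0 0 x₀)))) fun y => by
      have := ((hcont (n + 1) y).measurable).comp measurable_coe_nnreal_real
      exact ENNReal.measurable_ofReal.comp (Real.measurable_exp.comp
        ((this.sub_const _).const_mul θ)),
    ← lintegral_const_mul' _ _ ENNReal.ofReal_ne_top]
  refine lintegral_mono fun ω => ?_
  simp only
  generalize jumpTime H n ω = t
  generalize J n ω = x
  -- the drift of `F` over the next holding time
  have hp := stepProb_nnCond_nonneg (w := w) (ℓ := 0) (x := x) (hw := hw)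
    (hℓ := fun _ _ => le_rfl)
  have hp0 : ∀ s, stepProb (nnCond w 0) s x x = 0 := fun s => by
    rw [stepProb_nnCond_self]; simp
  have hp1 : ∀ s, stepProb (nnCond w 0) s x (x + 1) + stepProb (nnCond w 0) s x (x - 1) = 1 := by
    intro s
    have := stepProb_nnCond_add (w := w) (ℓ := 0) s x hw fun _ _ => le_rfl
    rwa [hp0, add_zero] at this
  set p : ℝ → ℝ := fun h => stepProb (nnCond w 0) (t + h.toNNReal) x (x + 1) with hpdef
  set q : ℝ → ℝ := fun h => stepProb (nnCond w 0) (t + h.toNNReal) x (x - 1) with hqdef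
  have hpm : Measurable p := (hμ x (x + 1)).comp (measurable_real_toNNReal.const_add t)
  have hqm : Measurable q := (hμ x (x - 1)).comp (measurable_real_toNNReal.const_add t)
  have hp' : ∀ h, 0 ≤ p h := fun h => hp _ _
  have hq' : ∀ h, 0 ≤ q h := fun h => hp _ _
  have hpq : ∀ h, p h + q h = 1 := fun h => hp1 _
  have hbr : ∀ h, 0 ≤ h → |F (n + 1) (t + h) (x + 1) - F n t x| ≤ K * (1 + h) := fun h hh =>
    hb n t h x (x + 1) hh (by simp)
  have hbl : ∀ h, 0 ≤ h → |F (n + 1) (t + h) (x - 1) - F n t x| ≤ K * (1 + h) := fun h hh =>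
    hb n t h x (x - 1) hh (by simp)
  obtain ⟨hint, hmean⟩ := integral_expMeasure_of_hasDeriv_right (K := 2 * K)
    (g := fun h => F n (t + h) x - F n t x)
    (m := fun h => p h * (F (n + 1) (t + h) (x + 1) - F n t x) +
      q h * (F (n + 1) (t + h) (x - 1) - F n t x)) (by positivity)
    (((hcont n x).comp (by fun_prop : Continuous fun h : ℝ => t + h)).sub
      continuous_const).continuousOn
    (fun h hh => by
      have h1 := hd n (t + h.toNNReal) x
      rw [NNReal.coe_add, Real.coe_toNNReal h hh] at h1
      have h2 : HasDerivWithinAt (fun h : ℝ => (t : ℝ) + h) 1 (Set.Ioi h) h :=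
        ((hasDerivAt_id h).const_add _).hasDerivWithinAt
      have h3 := (HasDerivWithinAt.comp h (h₂ := fun s => F n s x) h1 h2
        (fun s hs => add_lt_add_right (show h < s from hs) (t : ℝ))).sub_const (F n t x)
      refine h3.congr_deriv ?_
      change _ * 1 = _ - (p h * _ + q h * _)
      linear_combination - F n t x * hpq h)
    (by
      have m1 := (hcont (n + 1) (x + 1)).measurable.comp (measurable_id.const_add (t : ℝ))
      have m2 := (hcont (n + 1) (x - 1)).measurable.comp (measurable_id.const_add (t : ℝ))
      exact (hpm.mul (m1.sub_const _)).add (hqm.mul (m2.sub_const _)))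
    (fun h hh => by
      have h1 := hbr h hh
      have h2 := hb n (t + h) 0 x (x + 1) le_rfl (by simp)
      rw [add_zero] at h2
      rw [abs_le] at *
      constructor <;> nlinarith)
    (fun h hh => by
      have h1 := abs_le.1 (hbr h hh)
      have h2 := abs_le.1 (hbl h hh)
      have hc : 0 ≤ K * (1 + h) := by positivity
      have i1 := mul_le_mul_of_nonneg_left h1.1 (hp' h)
      have i2 := mul_le_mul_of_nonneg_left h1.2 (hp' h)
      have i3 := mul_le_mul_of_nonneg_left h2.1 (hq' h)
      have i4 := mul_le_mul_of_nonneg_left h2.2 (hq' h)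
      have i5 : p h * (K * (1 + h)) + q h * (K * (1 + h)) = K * (1 + h) := by
        rw [← add_mul, hpq, one_mul]
      rw [abs_le]
      constructor <;> linarith)
  simp only [add_zero, sub_self] at hmean
  set m : ℝ → ℝ := fun h => p h * (F (n + 1) (t + h) (x + 1) - F n t x) +
      q h * (F (n + 1) (t + h) (x - 1) - F n t x) with hm
  set R : ℝ → ℝ := fun h => 1 + θ * m h + θ ^ 2 * B * Real.exp (h / 2) with hR
  have hRint : Integrable R (expMeasure 1) :=
    ((integrable_const _).add (hint.const_mul θ)).add (integrable_exp_half.const_mul _)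
  have hRmean : ∫ h, R h ∂expMeasure 1 = 1 + B * I * θ ^ 2 := by
    have i1 : Integrable (fun h => 1 + θ * m h) (expMeasure 1) :=
      (integrable_const _).add (hint.const_mul θ)
    simp only [hR]
    rw [integral_add i1 (integrable_exp_half.const_mul _),
      integral_add (integrable_const _) (hint.const_mul θ),
      integral_const_mul, integral_const_mul, hmean]
    simp
    ring
  set E := Real.exp (θ * (F n t x - F 0 0 x₀)) with hE
  have hE0 : 0 < E := Real.exp_pos _
  have hsplit : ∀ s y, Real.exp (θ * (F (n + 1) s y - F 0 0 x₀)) =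
      E * Real.exp (θ * (F (n + 1) s y - F n t x)) := by
    intro s y
    rw [hE, ← Real.exp_add]; congr 1; ring
  have hR0 : ∀ h, 0 < h → p h * Real.exp (θ * (F (n + 1) (t + h) (x + 1) - F n t x)) +
      q h * Real.exp (θ * (F (n + 1) (t + h) (x - 1) - F n t x)) ≤ R h := by
    intro h hh
    have e1 := mul_le_mul_of_nonneg_left
      (exp_mul_le_of_abs_le hK hθ hh.le (hbr h hh.le)) (hp' h)
    have e2 := mul_le_mul_of_nonneg_left
      (exp_mul_le_of_abs_le hK hθ hh.le (hbl h hh.le)) (hq' h)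
    refine (add_le_add e1 e2).trans (le_of_eq ?_)
    simp only [hR, hm, hB]
    linear_combination (1 + θ ^ 2 * (32 * K ^ 2 * Real.exp (1 / 2)) * Real.exp (h / 2)) * hpq h
  calc _ ≤ ∫⁻ h, ENNReal.ofReal (E * R h) ∂expMeasure 1 := by
        refine lintegral_mono_ae ?_
        filter_upwards [ae_pos_expMeasure] with h hh
        rw [tsum_stepProb_nnCond_mul, hp0, ENNReal.ofReal_zero, zero_mul, add_zero,
          ← ENNReal.ofReal_mul (hp' h), ← ENNReal.ofReal_mul (hq' h), ← ENNReal.ofReal_add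
          (mul_nonneg (hp' h) (Real.exp_pos _).le) (mul_nonneg (hq' h) (Real.exp_pos _).le)]
        refine ENNReal.ofReal_le_ofReal ?_
        rw [NNReal.coe_add, Real.coe_toNNReal h hh.le, hsplit, hsplit]
        have := mul_le_mul_of_nonneg_left (hR0 h hh) hE0.le
        change p h * _ + q h * _ ≤ _
        linarith
    _ = ENNReal.ofReal (∫ h, E * R h ∂expMeasure 1) := by
        rw [ofReal_integral_eq_lintegral_ofReal (hRint.const_mul E)]
        filter_upwards [ae_pos_expMeasure] with h hh
        have h1 := mul_nonneg (hp' h)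
          (Real.exp_pos (θ * (F (n + 1) (t + h) (x + 1) - F n t x))).le
        have h2 := mul_nonneg (hq' h)
          (Real.exp_pos (θ * (F (n + 1) (t + h) (x - 1) - F n t x))).le
        exact mul_nonneg hE0.le (by linarith [hR0 h hh])
    _ = _ := by
        rw [integral_const_mul, hRmean, mul_comm, ENNReal.ofReal_mul (by positivity)]

end CSRW

/-! ### From the jump times and the skeleton to the path -/

section StepPath

variable {T : ℕ → ℝ≥0}

lemma tendsto_atTop_of_tendsto_div_one (hT : Tendsto (fun n : ℕ => (T n : ℝ) / n) atTop (𝓝 1)) :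
    Tendsto T atTop atTop := by
  have h : Tendsto (fun n : ℕ => (T n : ℝ)) atTop atTop := by
    refine (hT.pos_mul_atTop one_pos tendsto_natCast_atTop_atTop).congr' ?_
    filter_upwards [eventually_gt_atTop 0] with n hn
    have : (n : ℝ) ≠ 0 := by exact_mod_cast hn.ne'
    field_simp
  exact NNReal.tendsto_coe_atTop.1 h

lemma exists_mem_Ico_of_tendsto (h0 : T 0 = 0) (hT : Tendsto T atTop atTop) (t : ℝ≥0) :
    ∃ n, T n ≤ t ∧ t < T (n + 1) := by
  have hex : ∃ n, t < T n := (hT.eventually_gt_atTop t).exists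
  classical
  have hn0 : Nat.find hex ≠ 0 := fun h => by
    have := Nat.find_spec hex
    rw [h, h0] at this
    exact not_lt_zero this
  obtain ⟨k, hk⟩ := Nat.exists_eq_succ_of_ne_zero hn0
  refine ⟨k, not_lt.1 (Nat.find_min hex (by omega)), ?_⟩
  have := Nat.find_spec hex
  rwa [hk] at this

/-- The speed of a step path with asymptotic jump rate `1` is that of its skeleton. -/
lemma tendsto_stepPath_div {j : ℕ → ℤ} {y : ℝ≥0 → ℤ} {v : ℝ} (hmono : Monotone T) (h0 : T 0 = 0)
    (hT : Tendsto (fun n : ℕ => (T n : ℝ) / n) atTop (𝓝 1))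
    (hj : Tendsto (fun n : ℕ => (j n : ℝ) / n) atTop (𝓝 v))
    (hy : ∀ n t, T n ≤ t → t < T (n + 1) → y t = j n) :
    Tendsto (fun t : ℝ≥0 => (y t : ℝ) / (t : ℝ)) atTop (𝓝 v) := by
  have hTtop := tendsto_atTop_of_tendsto_div_one hT
  choose N hN1 hN2 using exists_mem_Ico_of_tendsto h0 hTtop
  have hN : Tendsto N atTop atTop := by
    refine tendsto_atTop.2 fun k => ?_
    filter_upwards [eventually_ge_atTop (T k)] with t ht
    by_contra hlt
    exact absurd ((hN2 t).trans_le (hmono (by omega))) (not_lt.2 ht)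
  have hT' : Tendsto (fun n : ℕ => (T (n + 1) : ℝ) / n) atTop (𝓝 1) := by
    have h1 := (tendsto_add_atTop_iff_nat 1).2 hT
    have h2 : Tendsto (fun n : ℕ => ((n + 1 : ℕ) : ℝ) / n) atTop (𝓝 1) := by
      have := (tendsto_const_div_atTop_nhds_zero_nat (1 : ℝ)).const_add 1
      rw [add_zero] at this
      refine this.congr' ?_
      filter_upwards [eventually_gt_atTop 0] with n hn
      have : (n : ℝ) ≠ 0 := by exact_mod_cast hn.ne'
      push_cast
      field_simp
    have h3 := h1.mul h2
    rw [one_mul] at h3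
    refine h3.congr fun n => ?_
    have : ((n + 1 : ℕ) : ℝ) ≠ 0 := by positivity
    rw [div_mul_div_cancel₀ this]
  have hratio : Tendsto (fun t : ℝ≥0 => (t : ℝ) / N t) atTop (𝓝 1) := by
    refine tendsto_of_tendsto_of_tendsto_of_le_of_le (hT.comp hN) (hT'.comp hN) (fun t => ?_)
      fun t => ?_
    · exact div_le_div_of_nonneg_right (NNReal.coe_le_coe.2 (hN1 t)) (Nat.cast_nonneg _)
    · exact div_le_div_of_nonneg_right (NNReal.coe_le_coe.2 (hN2 t).le) (Nat.cast_nonneg _)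
  have h := (hj.comp hN).div hratio one_ne_zero
  rw [div_one] at h
  refine h.congr' ?_
  filter_upwards [hN.eventually_gt_atTop 0, eventually_gt_atTop 0] with t ht ht'
  have h1 : (N t : ℝ) ≠ 0 := by exact_mod_cast ht.ne'
  simp only [Pi.div_apply, Function.comp]
  rw [div_div_div_cancel_right₀ h1, hy (N t) t (hN1 t) (hN2 t)]

/-- Returns can only take place at jump times. -/
lemma finite_returns {j : ℕ → ℤ} {y : ℝ≥0 → ℤ} {z : ℤ} (h0 : T 0 = 0)
    (hT : Tendsto T atTop atTop) (hy : ∀ n t, T n ≤ t → t < T (n + 1) → y t = j n)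
    (hb : BddAbove {t | y t = z}) :
    {t | y t = z ∧ ∃ s < t, ∀ r, s ≤ r → r < t → y r ≠ z}.Finite := by
  obtain ⟨b, hb⟩ := hb
  have hfin : {n | T n ≤ b}.Finite := by
    have := hT.eventually_gt_atTop b
    rw [← Nat.cofinite_eq_atTop, eventually_cofinite] at this
    simpa using this
  refine (hfin.image T).subset ?_
  rintro t ⟨ht, s, hs, hr⟩
  obtain ⟨n, h1, h2⟩ := exists_mem_Ico_of_tendsto h0 hT t
  have heq : T n = t := by
    by_contra hne
    have hlt := lt_of_le_of_ne h1 hne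
    refine hr (max s (T n)) (le_max_left _ _) (max_lt hs hlt) ?_
    rw [hy n _ (le_max_right _ _) ((max_lt hs hlt).trans h2), ← hy n t h1 h2, ht]
  exact ⟨n, by rw [Set.mem_ofPred_eq, heq]; exact hb ht, heq⟩

end StepPath

/-- Exponentially small deviations of the jump times and of the positions from a nonzero speed give
all the assertions about a CSRW. For the on-diagonal bound, if the walk is at `x₀` at time `n`, then
either fewer than `n / 2` jumps have been made or the skeleton visits `x₀` after step `n / 2`. -/
lemma csrw_conclusion {Ω : Type*} [MeasurableSpace Ω] {P : Measure Ω} [IsProbabilityMeasure P]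
    {Y : ℝ≥0 → Ω → ℤ} {J : ℕ → Ω → ℤ} {H : ℕ → Ω → ℝ≥0} {μ : ℝ≥0 → ℤ → ℤ → ℝ} {x₀ : ℤ} {W v : ℝ}
    (hW : ∀ t y, vertexWeight μ t y ∈ Set.Icc 1 W) (hX : IsCSRWWith μ P Y J H) (hv : v ≠ 0)
    (hT : ExpSmall P fun n ω => (jumpTime H n ω : ℝ) - n)
    (hJ : ExpSmall P fun n ω => (J n ω : ℝ) - x₀ - v * jumpTime H n ω) :
    IsBallistic (fun t : ℝ≥0 => (t : ℝ)) P Y ∧ IsTransientCont P Y ∧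
      ¬ OnDiagLowerBound (fun t : ℝ≥0 => (t : ℝ)) (heatKernel μ P Y) x₀ ∧
      ¬ OffDiagUpperBound (fun t : ℝ≥0 => (t : ℝ)) (heatKernel μ P Y) x₀ := by
  have hJn : ExpSmall P fun n ω => (J n ω : ℝ) - x₀ - v * n := by
    have h := hJ.add (hT.const_mul v)
    have e : (fun (n : ℕ) ω => (J n ω : ℝ) - x₀ - v * n) = fun n ω =>
        ((J n ω : ℝ) - x₀ - v * jumpTime H n ω) + v * ((jumpTime H n ω : ℝ) - n) := by
      ext n ω; ring
    rw [e]; exact h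
  have hTlim : ∀ᵐ ω ∂P, Tendsto (fun n : ℕ => (jumpTime H n ω : ℝ) / n) atTop (𝓝 1) := by
    filter_upwards [hT.tendsto_div] with ω hω
    have h1 := hω.add_const 1
    rw [zero_add] at h1
    refine h1.congr' ?_
    filter_upwards [eventually_gt_atTop 0] with n hn
    have : (n : ℝ) ≠ 0 := by exact_mod_cast hn.ne'
    field_simp
    ring
  have hJlim : ∀ᵐ ω ∂P, Tendsto (fun n : ℕ => (J n ω : ℝ) / n) atTop (𝓝 v) := by
    filter_upwards [hJn.tendsto_div] with ω hω
    have h1 := (hω.add (tendsto_const_div_atTop_nhds_zero_nat (x₀ : ℝ))).add_const v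
    simp only [add_zero, zero_add] at h1
    refine h1.congr' ?_
    filter_upwards [eventually_gt_atTop 0] with n hn
    have : (n : ℝ) ≠ 0 := by exact_mod_cast hn.ne'
    field_simp
    ring
  have hzero : ∀ ω, jumpTime H 0 ω = 0 := fun ω => by simp [jumpTime]
  have hlim : ∀ᵐ ω ∂P, Tendsto (fun t : ℝ≥0 => (Y t ω : ℝ) / (t : ℝ)) atTop (𝓝 v) := by
    filter_upwards [hTlim, hJlim, hX.path] with ω h1 h2 h3
    exact tendsto_stepPath_div (jumpTime_mono H ω) (hzero ω) h1 h2 h3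
  have hball : IsBallistic (fun t : ℝ≥0 => (t : ℝ)) P Y := ⟨v, hv, hlim⟩
  have htn : Tendsto (fun n : ℕ => (n : ℝ≥0)) atTop atTop := tendsto_natCast_atTop_atTop
  refine ⟨hball, ?_, ?_, not_offDiagUpperBound (tn := fun n : ℕ => (n : ℝ≥0)) (fun n => by simp)
    htn hW hX.measurable hball⟩
  · filter_upwards [hlim, hTlim, hX.path] with ω h1 h2 h3
    have hev := eventually_ne_of_tendsto_div (NNReal.tendsto_coe_atTop.2 tendsto_id) hv h1 (Y 0 ω)
    obtain ⟨b, hb⟩ := eventually_atTop.1 hev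
    have hbdd : BddAbove {t | Y t ω = Y 0 ω} := by
      refine ⟨b, fun t ht => not_lt.1 fun hlt => hb t hlt.le ?_⟩
      rw [show Y t ω = Y 0 ω from ht]
    exact ⟨finite_returns (hzero ω) (tendsto_atTop_of_tendsto_div_one h2) h3 hbdd, hbdd⟩
  · obtain ⟨A, c, hA, hc, hAc⟩ := hJn |v| (abs_pos.2 hv)
    obtain ⟨A', c', hA', hc', hAc'⟩ := hT 1 one_pos
    have hvisit : ∀ k, P.real {ω | J k ω = x₀} ≤ A * Real.exp (-c * k) := fun k => by
      refine (measureReal_mono fun ω hω => ?_).trans (hAc k)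
      have hω' : J k ω = x₀ := hω
      change |v| * k ≤ |(J k ω : ℝ) - x₀ - v * k|
      rw [hω', sub_self, zero_sub, abs_neg, abs_mul, Nat.abs_cast]
    -- a visit to `x₀` from step `m` on, by the union bound
    have htail : ∀ m, P.real (⋃ k, {ω | J (m + k) ω = x₀}) ≤
        A * Real.exp (-c * m) * ∑' k : ℕ, Real.exp (-c * k) := by
      intro m
      have hs : Summable fun k : ℕ => Real.exp (-c * k) := by
        simpa using Real.summable_pow_mul_exp_neg_nat_mul 0 hc
      have hs' := hs.mul_left (A * Real.exp (-c * m))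
      rw [← tsum_mul_left]
      refine ENNReal.toReal_le_of_le_ofReal (tsum_nonneg fun k => by positivity) ?_
      rw [ENNReal.ofReal_tsum_of_nonneg (fun k => by positivity) hs']
      refine (measure_iUnion_le _).trans (ENNReal.tsum_le_tsum fun k => ?_)
      rw [← ofReal_measureReal]
      refine ENNReal.ofReal_le_ofReal ((hvisit (m + k)).trans (le_of_eq ?_))
      rw [mul_assoc, ← Real.exp_add]
      congr 2; push_cast; ring
    set S := ∑' k : ℕ, Real.exp (-c * k) with hS
    have hS0 : 0 ≤ S := tsum_nonneg fun k => (Real.exp_pos _).le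
    set d := min c c' with hd
    have hd0 : 0 < d := lt_min hc hc'
    refine not_onDiagLowerBound (tn := fun n : ℕ => (n : ℝ≥0)) (c := d / 2)
      (A := (A' + A * S) * Real.exp (d / 2)) (fun n => by simp) (fun t y => (hW t y).1)
      (by positivity) fun n => ?_
    set m := n / 2 with hm
    have hcover : ∀ᵐ ω ∂P, ω ∈ {ω | Y n ω = x₀} →
        ω ∈ {ω | 1 * (m : ℝ) ≤ |(jumpTime H m ω : ℝ) - m|} ∪ ⋃ k, {ω | J (m + k) ω = x₀} := by
      filter_upwards [hTlim, hX.path] with ω h2 h3 hω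
      have hω' : Y n ω = x₀ := hω
      obtain ⟨k, hk1, hk2⟩ := exists_mem_Ico_of_tendsto (hzero ω)
        (tendsto_atTop_of_tendsto_div_one h2) (n : ℝ≥0)
      by_cases hkm : m ≤ k
      · right
        refine Set.mem_iUnion.2 ⟨k - m, ?_⟩
        change J (m + (k - m)) ω = x₀
        rw [Nat.add_sub_cancel' hkm, ← h3 k n hk1 hk2, hω']
      · left
        have h4 : (n : ℝ≥0) < jumpTime H m ω := hk2.trans_le (jumpTime_mono H ω (by omega))
        have h5 : (n : ℝ) < jumpTime H m ω := by exact_mod_cast h4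
        have h6 : (2 : ℝ) * m ≤ n := by exact_mod_cast (by omega : 2 * m ≤ n)
        change 1 * (m : ℝ) ≤ |(jumpTime H m ω : ℝ) - m|
        exact le_trans (by linarith) (le_abs_self _)
    have hexp : ∀ a, d ≤ a → Real.exp (-a * m) ≤ Real.exp (d / 2) * Real.exp (-(d / 2) * n) := by
      intro a ha
      rw [← Real.exp_add]
      refine Real.exp_le_exp.2 ?_
      have h6 : (n : ℝ) ≤ 2 * m + 1 := by exact_mod_cast (by omega : n ≤ 2 * m + 1)
      have h7 : d * m ≤ a * m := mul_le_mul_of_nonneg_right ha (Nat.cast_nonneg _)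
      have h8 := mul_le_mul_of_nonneg_left h6 hd0.le
      linarith
    have e1 : P.real {ω | Y n ω = x₀} ≤ P.real {ω | 1 * (m : ℝ) ≤ |(jumpTime H m ω : ℝ) - m|} +
        P.real (⋃ k, {ω | J (m + k) ω = x₀}) :=
      (ENNReal.toReal_mono (measure_ne_top _ _) (measure_mono_ae hcover)).trans
        (measureReal_union_le _ _)
    have e2 := mul_le_mul_of_nonneg_left (hexp c' (min_le_right _ _)) hA'
    have e3 := mul_le_mul_of_nonneg_left (hexp c (min_le_left _ _)) (mul_nonneg hA hS0)
    calc P.real {ω | Y n ω = x₀} ≤ A' * Real.exp (-c' * m) + A * Real.exp (-c * m) * S :=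
          e1.trans (add_le_add (hAc' m) (htail m))
      _ ≤ _ := by linarith

/-! ### Rotating conductances of period three -/

/-- The weight of the edge `{x, x + 1}` at time `t`: every third edge has weight `1 + e`, the others
have weight `1`, and the pattern moves one step to the right at each multiple of `s`. -/
noncomputable def rotEdge (e s : ℝ) (t : ℝ) (x : ℤ) : ℝ := if (x - ⌊t / s⌋) % 3 = 0 then 1 + e else 1

/-- Decay rate of the antisymmetric mode (values `1, -1, 0`) of the walk modulo `3` seen from the
pattern. This mode is also the shape of the local drift. -/
noncomputable def rotRate₁ (e : ℝ) : ℝ := (3 + 2 * e) / (2 + e)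

/-- Decay rate of the symmetric mode of the walk modulo `3` seen from the pattern. -/
noncomputable def rotRate₂ (e : ℝ) : ℝ := (3 + e) / (2 + e)

/-- Amplitude of the antisymmetric mode in the corrector immediately after a rotation. -/
noncomputable def rotAmp₁ (e s : ℝ) : ℝ :=
  e / (3 + 2 * e) * (Real.exp (rotRate₁ e * s) - 1) /
    (Real.exp (rotRate₁ e * s) +
      (Real.exp (rotRate₂ e * s) + 2) / (2 * Real.exp (rotRate₂ e * s) + 1))

/-- Amplitude of the symmetric mode in the corrector immediately after a rotation. -/
noncomputable def rotAmp₂ (e s : ℝ) : ℝ := -3 * rotAmp₁ e s / (2 * Real.exp (rotRate₂ e * s) + 1)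

/-- The mean displacement of the walk between two rotations. -/
noncomputable def rotShift (e s : ℝ) : ℝ :=
  rotAmp₂ e s * (1 - Real.exp (rotRate₂ e * s)) * (e / (3 + e)) / 3

/-- The antisymmetric coefficient of the corrector, at time `τ` after the last rotation. -/
noncomputable def rotCoeff₁ (e s τ : ℝ) : ℝ :=
  e / (3 + 2 * e) + (rotAmp₁ e s - e / (3 + 2 * e)) * Real.exp (rotRate₁ e * τ)

/-- The symmetric coefficient of the corrector, at time `τ` after the last rotation. -/
noncomputable def rotCoeff₂ (e s τ : ℝ) : ℝ := rotAmp₂ e s * Real.exp (rotRate₂ e * τ)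

/-- The corrector, at time `τ` after the last rotation and at position `z` relative to the
pattern. -/
noncomputable def rotCorrector (e s τ : ℝ) (z : ℤ) : ℝ :=
  if z % 3 = 0 then rotCoeff₁ e s τ - rotCoeff₂ e s τ / (3 + e)
  else if z % 3 = 1 then -rotCoeff₁ e s τ - rotCoeff₂ e s τ / (3 + e)
  else rotCoeff₂ e s τ - rotCoeff₂ e s τ / (3 + e)

/-- The corrected, compensated position of the walk, a space-time harmonic function. -/
noncomputable def rotHarmonic (e s t : ℝ) (x : ℤ) : ℝ :=
  x - ⌊t / s⌋ * rotShift e s + rotCorrector e s (t - ⌊t / s⌋ * s) (x - ⌊t / s⌋)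

section Rotating

variable {e s : ℝ}

lemma rotEdge_mem (he : 0 ≤ e) (t : ℝ) (x : ℤ) : rotEdge e s t x ∈ Set.Icc 1 (1 + e) := by
  unfold rotEdge
  split_ifs <;> constructor <;> linarith

lemma measurable_rotEdge (x : ℤ) : Measurable fun t => rotEdge e s t x :=
  (measurable_of_countable fun k : ℤ => if (x - k) % 3 = 0 then 1 + e else 1).comp
    (Int.measurable_floor.comp (measurable_id.div_const s))

lemma rotAmp₁_pos (he : 0 < e) (hs : 0 < s) : 0 < rotAmp₁ e s := by
  have h1 : 1 < Real.exp (rotRate₁ e * s) :=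
    Real.one_lt_exp_iff.2 (mul_pos (by unfold rotRate₁; positivity) hs)
  have h2 : 0 < Real.exp (rotRate₁ e * s) - 1 := by linarith
  unfold rotAmp₁
  positivity

lemma rotShift_pos (he : 0 < e) (hs : 0 < s) : 0 < rotShift e s := by
  have h1 : 1 < Real.exp (rotRate₂ e * s) :=
    Real.one_lt_exp_iff.2 (mul_pos (by unfold rotRate₂; positivity) hs)
  have h2 : 0 < Real.exp (rotRate₂ e * s) - 1 := by linarith
  have h3 := rotAmp₁_pos he hs
  have : rotShift e s = 3 * rotAmp₁ e s / (2 * Real.exp (rotRate₂ e * s) + 1) *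
      (Real.exp (rotRate₂ e * s) - 1) * (e / (3 + e)) / 3 := by
    unfold rotShift rotAmp₂; ring
  rw [this]
  positivity

/-- At a rotation the corrector changes continuously, up to the displacement `rotShift`: the
amplitudes and `rotShift` are the solution of these three linear equations. -/
lemma rotCorrector_rotate (he : 0 < e) (z : ℤ) :
    rotCorrector e s s z = rotCorrector e s 0 (z - 1) - rotShift e s := by
  have hE2 : 0 < 2 * Real.exp (rotRate₂ e * s) + 1 := by positivity
  have hden : 0 < Real.exp (rotRate₁ e * s) +
      (Real.exp (rotRate₂ e * s) + 2) / (2 * Real.exp (rotRate₂ e * s) + 1) := by positivity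
  have he3 : 0 < 3 + e := by linarith
  -- the two equations that determine the amplitudes
  have hA : rotCoeff₁ e s s * (2 * Real.exp (rotRate₂ e * s) + 1) =
      -rotAmp₁ e s * (Real.exp (rotRate₂ e * s) + 2) := by
    have h1 : rotAmp₁ e s * (Real.exp (rotRate₁ e * s) +
        (Real.exp (rotRate₂ e * s) + 2) / (2 * Real.exp (rotRate₂ e * s) + 1)) =
        e / (3 + 2 * e) * (Real.exp (rotRate₁ e * s) - 1) := by
      unfold rotAmp₁
      rw [div_mul_cancel₀ _ hden.ne']
    have h2 : (Real.exp (rotRate₂ e * s) + 2) / (2 * Real.exp (rotRate₂ e * s) + 1) *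
        (2 * Real.exp (rotRate₂ e * s) + 1) = Real.exp (rotRate₂ e * s) + 2 :=
      div_mul_cancel₀ _ hE2.ne'
    unfold rotCoeff₁
    linear_combination (2 * Real.exp (rotRate₂ e * s) + 1) * h1 - rotAmp₁ e s * h2
  have hB : rotAmp₂ e s * (2 * Real.exp (rotRate₂ e * s) + 1) = -3 * rotAmp₁ e s := by
    unfold rotAmp₂
    rw [div_mul_cancel₀ _ hE2.ne']
  have hA' : 3 * rotCoeff₁ e s s = rotAmp₂ e s * (Real.exp (rotRate₂ e * s) + 2) := by
    have : (3 * rotCoeff₁ e s s) * (2 * Real.exp (rotRate₂ e * s) + 1) =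
        (rotAmp₂ e s * (Real.exp (rotRate₂ e * s) + 2)) *
          (2 * Real.exp (rotRate₂ e * s) + 1) := by
      linear_combination 3 * hA - (Real.exp (rotRate₂ e * s) + 2) * hB
    exact mul_right_cancel₀ hE2.ne' this
  have h10 : rotCoeff₁ e s 0 = rotAmp₁ e s := by simp [rotCoeff₁]
  have h20 : rotCoeff₂ e s 0 = rotAmp₂ e s := by simp [rotCoeff₂]
  have h2s : rotCoeff₂ e s s = rotAmp₂ e s * Real.exp (rotRate₂ e * s) := rfl
  have hcases : z % 3 = 0 ∨ z % 3 = 1 ∨ z % 3 = 2 := by omega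
  unfold rotCorrector rotShift
  rw [h10, h20, h2s]
  rcases hcases with h | h | h
  · have h' : (z - 1) % 3 = 2 := by omega
    simp only [h, h', if_true, if_false, show (2 : ℤ) ≠ 0 by norm_num,
      show (2 : ℤ) ≠ 1 by norm_num]
    field_simp
    linear_combination (3 + e) * hA'
  · have h' : (z - 1) % 3 = 0 := by omega
    simp only [h, h', if_true, if_false, show (1 : ℤ) ≠ 0 by norm_num]
    field_simp
    linear_combination (-(3 + e)) * hA' - (3 + e) * hB
  · have h' : (z - 1) % 3 = 1 := by omega
    simp only [h, h', if_true, if_false, show (2 : ℤ) ≠ 0 by norm_num,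
      show (2 : ℤ) ≠ 1 by norm_num, show (1 : ℤ) ≠ 0 by norm_num]
    field_simp
    linear_combination (3 + e) * hB

lemma hasDerivAt_rotCoeff₁ (τ : ℝ) : HasDerivAt (rotCoeff₁ e s)
    (rotRate₁ e * (rotCoeff₁ e s τ - e / (3 + 2 * e))) τ := by
  have h : HasDerivAt (fun τ : ℝ => Real.exp (rotRate₁ e * τ))
      (Real.exp (rotRate₁ e * τ) * (rotRate₁ e * 1)) τ :=
    ((hasDerivAt_id τ).const_mul _).exp
  refine ((h.const_mul (rotAmp₁ e s - e / (3 + 2 * e))).const_add _).congr_deriv ?_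
  unfold rotCoeff₁
  ring

lemma hasDerivAt_rotCoeff₂ (τ : ℝ) : HasDerivAt (rotCoeff₂ e s)
    (rotRate₂ e * rotCoeff₂ e s τ) τ := by
  have h : HasDerivAt (fun τ : ℝ => Real.exp (rotRate₂ e * τ))
      (Real.exp (rotRate₂ e * τ) * (rotRate₂ e * 1)) τ :=
    ((hasDerivAt_id τ).const_mul _).exp
  refine (h.const_mul (rotAmp₂ e s)).congr_deriv ?_
  unfold rotCoeff₂
  ring

/-- The weight of the edge `{z, z + 1}`, relative to the pattern. -/
noncomputable def rotPattern (e : ℝ) (z : ℤ) : ℝ := if z % 3 = 0 then 1 + e else 1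

/-- Between rotations the corrector solves the backward equation, with the local drift as source. -/
lemma hasDerivAt_rotCorrector (he : 0 < e) (τ : ℝ) (z : ℤ) :
    HasDerivAt (fun τ => rotCorrector e s τ z)
      (rotCorrector e s τ z -
        (rotPattern e z / (rotPattern e z + rotPattern e (z - 1)) *
            (1 + rotCorrector e s τ (z + 1)) +
          rotPattern e (z - 1) / (rotPattern e z + rotPattern e (z - 1)) *
            (-1 + rotCorrector e s τ (z - 1)))) τ := by
  have h1 := hasDerivAt_rotCoeff₁ (e := e) (s := s) τ
  have h2 := hasDerivAt_rotCoeff₂ (e := e) (s := s) τ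
  have hcases : z % 3 = 0 ∨ z % 3 = 1 ∨ z % 3 = 2 := by omega
  have he2 : (2 : ℝ) + e ≠ 0 := by linarith
  have he2' : (1 + e) + 1 ≠ 0 := by linarith
  have he2'' : (1 : ℝ) + (1 + e) ≠ 0 := by linarith
  have he3 : (3 : ℝ) + e ≠ 0 := by linarith
  have he3' : (3 : ℝ) + 2 * e ≠ 0 := by linarith
  unfold rotCorrector rotPattern
  rcases hcases with h | h | h
  · have h' : (z - 1) % 3 = 2 := by omega
    have h'' : (z + 1) % 3 = 1 := by omega
    simp only [h, h', h'', if_true, if_false, show (2 : ℤ) ≠ 0 by norm_num,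
      show (2 : ℤ) ≠ 1 by norm_num, show (1 : ℤ) ≠ 0 by norm_num]
    refine (h1.sub (h2.div_const _)).congr_deriv ?_
    unfold rotRate₁ rotRate₂
    field_simp
    ring
  · have h' : (z - 1) % 3 = 0 := by omega
    have h'' : (z + 1) % 3 = 2 := by omega
    simp only [h, h', h'', if_true, if_false, show (2 : ℤ) ≠ 0 by norm_num,
      show (2 : ℤ) ≠ 1 by norm_num, show (1 : ℤ) ≠ 0 by norm_num]
    refine (h1.neg.sub (h2.div_const _)).congr_deriv ?_
    unfold rotRate₁ rotRate₂
    field_simp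
    ring
  · have h' : (z - 1) % 3 = 1 := by omega
    have h'' : (z + 1) % 3 = 0 := by omega
    simp only [h, h', h'', if_true, if_false, show (2 : ℤ) ≠ 0 by norm_num,
      show (2 : ℤ) ≠ 1 by norm_num, show (1 : ℤ) ≠ 0 by norm_num]
    refine (h2.sub (h2.div_const _)).congr_deriv ?_
    unfold rotRate₂
    field_simp
    ring

lemma floor_div_eq (hs : 0 < s) {t : ℝ} {k : ℤ} (h1 : k * s ≤ t) (h2 : t < (k + 1) * s) :
    ⌊t / s⌋ = k :=
  Int.floor_eq_iff.2 ⟨(le_div_iff₀ hs).2 h1, (div_lt_iff₀ hs).2 h2⟩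

lemma floor_mul_le (hs : 0 < s) (t : ℝ) : ⌊t / s⌋ * s ≤ t :=
  (le_div_iff₀ hs).1 (Int.floor_le _)

lemma lt_floor_add_one_mul (hs : 0 < s) (t : ℝ) : t < (⌊t / s⌋ + 1) * s :=
  (div_lt_iff₀ hs).1 (Int.lt_floor_add_one _)

/-- On the closed interval between two rotations, `rotHarmonic` is given by a smooth expression. -/
lemma rotHarmonic_eq (he : 0 < e) (hs : 0 < s) {t : ℝ} {k : ℤ} (h1 : k * s ≤ t)
    (h2 : t ≤ (k + 1) * s) (x : ℤ) :
    rotHarmonic e s t x = x - k * rotShift e s + rotCorrector e s (t - k * s) (x - k) := by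
  rcases h2.lt_or_eq with h2 | rfl
  · unfold rotHarmonic
    rw [floor_div_eq hs h1 h2]
  · have hf : ⌊((k : ℝ) + 1) * s / s⌋ = k + 1 := by
      rw [mul_div_cancel_right₀ _ hs.ne']
      exact_mod_cast Int.floor_intCast (k + 1)
    have h := rotCorrector_rotate (s := s) he (x - k)
    unfold rotHarmonic
    rw [hf, show ((k : ℝ) + 1) * s - k * s = s by ring, h, sub_sub x k 1]
    push_cast
    rw [sub_self]
    ring

lemma continuous_rotHarmonic (he : 0 < e) (hs : 0 < s) (x : ℤ) :
    Continuous fun t => rotHarmonic e s t x := by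
  have hG : ∀ k : ℤ, Continuous fun t : ℝ =>
      (x : ℝ) - k * rotShift e s + rotCorrector e s (t - k * s) (x - k) := fun k => by
    have h : Continuous fun τ => rotCorrector e s τ (x - k) :=
      continuous_iff_continuousAt.2 fun τ => (hasDerivAt_rotCorrector he τ _).continuousAt
    exact continuous_const.add (h.comp (continuous_id.sub continuous_const))
  refine continuous_iff_continuousAt.2 fun t => continuousAt_iff_continuous_left_right.2 ⟨?_, ?_⟩
  · set k : ℤ := ⌈t / s⌉ - 1 with hk
    have h1 : (k : ℝ) * s < t := by
      rw [← lt_div_iff₀ hs, hk]; push_cast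
      linarith [Int.ceil_lt_add_one (t / s)]
    have h2 : t ≤ (k + 1) * s := by
      rw [← div_le_iff₀ hs, hk]; push_cast
      linarith [Int.le_ceil (t / s)]
    refine (hG k).continuousWithinAt.congr_of_eventuallyEq ?_ (rotHarmonic_eq he hs h1.le h2 x)
    filter_upwards [Ioc_mem_nhdsLE h1] with r hr
    exact rotHarmonic_eq he hs hr.1.le (hr.2.trans h2) x
  · have h1 := floor_mul_le hs t
    have h2 := lt_floor_add_one_mul hs t
    refine (hG ⌊t / s⌋).continuousWithinAt.congr_of_eventuallyEq ?_
      (rotHarmonic_eq he hs h1 h2.le x)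
    filter_upwards [Ico_mem_nhdsGE h2] with r hr
    exact rotHarmonic_eq he hs (h1.trans hr.1) hr.2.le x

lemma hasDerivWithinAt_rotHarmonic (he : 0 < e) (hs : 0 < s) (t : ℝ) (x : ℤ) :
    HasDerivWithinAt (fun t => rotHarmonic e s t x)
      (rotHarmonic e s t x -
        (rotEdge e s t x / (rotEdge e s t x + rotEdge e s t (x - 1)) *
            rotHarmonic e s t (x + 1) +
          rotEdge e s t (x - 1) / (rotEdge e s t x + rotEdge e s t (x - 1)) *
            rotHarmonic e s t (x - 1))) (Set.Ioi t) t := by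
  set k := ⌊t / s⌋ with hk
  have h1 : k * s ≤ t := floor_mul_le hs t
  have h2 : t < (k + 1) * s := lt_floor_add_one_mul hs t
  have hd := ((hasDerivAt_rotCorrector (s := s) he (t - k * s) (x - k)).comp_sub_const t
    (k * s)).const_add ((x : ℝ) - k * rotShift e s)
  have heq : ∀ y, rotHarmonic e s t y =
      y - k * rotShift e s + rotCorrector e s (t - k * s) (y - k) := fun y =>
    rotHarmonic_eq he hs h1 h2.le y
  refine (hd.hasDerivWithinAt.congr_of_eventuallyEq ?_ (heq x)).congr_deriv ?_
  · filter_upwards [Ioo_mem_nhdsGT h2] with r hr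
    exact rotHarmonic_eq he hs (h1.trans hr.1.le) hr.2.le x
  · have e1 : rotEdge e s t x = rotPattern e (x - k) := rfl
    have e2 : rotEdge e s t (x - 1) = rotPattern e (x - k - 1) := by
      rw [show x - k - 1 = x - 1 - k by ring]; rfl
    have hpos : ∀ z, 0 < rotPattern e z := fun z => by unfold rotPattern; split_ifs <;> linarith
    have hsum : rotPattern e (x - k) / (rotPattern e (x - k) + rotPattern e (x - k - 1)) +
        rotPattern e (x - k - 1) / (rotPattern e (x - k) + rotPattern e (x - k - 1)) = 1 := by
      rw [← add_div, div_self (add_pos (hpos _) (hpos _)).ne']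
    rw [heq, heq, heq, e1, e2, show x + 1 - k = x - k + 1 by ring,
      show x - 1 - k = x - k - 1 by ring]
    push_cast
    linear_combination ((x : ℝ) - k * rotShift e s) * hsum

lemma exists_abs_rotHarmonic_sub_le (he : 0 < e) (hs : 0 < s) :
    ∃ C, 0 ≤ C ∧ ∀ t x, |rotHarmonic e s t x - (x - rotShift e s / s * t)| ≤ C := by
  have hA : ∃ C, ∀ τ ∈ Set.Icc 0 s, ∀ z, |rotCorrector e s τ z| ≤ C := by
    have hc : ∀ z, ∃ C, ∀ τ ∈ Set.Icc 0 s, ‖rotCorrector e s τ z‖ ≤ C := fun z =>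
      isCompact_Icc.exists_bound_of_continuousOn fun τ _ =>
        (hasDerivAt_rotCorrector he τ z).continuousAt.continuousWithinAt
    choose C hC using hc
    refine ⟨max (C 0) (max (C 1) (C 2)), fun τ hτ z => ?_⟩
    have hz : ∀ r, z % 3 = r % 3 → rotCorrector e s τ z = rotCorrector e s τ r := fun r hr => by
      unfold rotCorrector; rw [hr]
    have hcases : z % 3 = 0 ∨ z % 3 = 1 ∨ z % 3 = 2 := by omega
    rcases hcases with h | h | h
    · rw [hz 0 (by omega)]
      exact (hC 0 τ hτ).trans (le_max_left _ _)
    · rw [hz 1 (by omega)]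
      exact (hC 1 τ hτ).trans ((le_max_left _ _).trans (le_max_right _ _))
    · rw [hz 2 (by omega)]
      exact (hC 2 τ hτ).trans ((le_max_right _ _).trans (le_max_right _ _))
  obtain ⟨C, hC⟩ := hA
  have hC0 : 0 ≤ C := (abs_nonneg _).trans (hC 0 ⟨le_rfl, hs.le⟩ 0)
  have hm := rotShift_pos he hs
  refine ⟨rotShift e s + C, by positivity, fun t x => ?_⟩
  have h1 := floor_mul_le hs t
  have h2 := lt_floor_add_one_mul hs t
  have h3 := hC (t - ⌊t / s⌋ * s) ⟨by linarith, by linarith⟩ (x - ⌊t / s⌋)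
  have h4 := Int.floor_le (t / s)
  have h5 := Int.lt_floor_add_one (t / s)
  have e1 : rotHarmonic e s t x - (x - rotShift e s / s * t) =
      rotShift e s * (t / s - ⌊t / s⌋) + rotCorrector e s (t - ⌊t / s⌋ * s) (x - ⌊t / s⌋) := by
    unfold rotHarmonic; ring
  rw [e1]
  refine (abs_add_le _ _).trans (add_le_add ?_ h3)
  rw [abs_mul, abs_of_pos hm]
  refine mul_le_of_le_one_right hm.le (abs_le.2 ⟨by linarith, by linarith⟩)

end Rotating

section RotatingWalk

variable {e : ℝ} {s : ℝ≥0}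

/-- The edge weights `rotEdge`, indexed by nonnegative times. -/
noncomputable def rotWeight (e : ℝ) (s t : ℝ≥0) (x : ℤ) : ℝ := rotEdge e s t x

lemma rotWeight_pos (he : 0 < e) (t : ℝ≥0) (x : ℤ) : 0 < rotWeight e s t x := by
  linarith [(rotEdge_mem (s := s) he.le t x).1, show rotWeight e s t x = rotEdge e s t x from rfl]

lemma measurable_stepProb_rotWeight (x y : ℤ) :
    Measurable fun t => stepProb (nnCond (rotWeight e s) 0) t x y := by
  have h : ∀ x, Measurable fun t => rotWeight e s t x := fun x =>
    (measurable_rotEdge x).comp measurable_coe_nnreal_real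
  simp only [stepProb, vertexWeight_nnCond]
  refine Measurable.div ?_ (((h x).add (h (x - 1))).add_const _)
  unfold nnCond
  split_ifs
  exacts [h x, h y, measurable_const, measurable_const]

lemma changesExactlyAt_rotWeight (he : 0 < e) (hs : 0 < s) :
    ChangesExactlyAt (nnCond (rotWeight e s) 0) (fun n : ℕ => (n : ℝ≥0) * s) := by
  have hs' : (0 : ℝ) < s := hs
  have hfloor : ∀ (n : ℕ) (t : ℝ≥0), n * s ≤ t → t < ((n + 1 : ℕ) : ℝ≥0) * s →
      ⌊(t : ℝ) / s⌋ = n := by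
    intro n t h1 h2
    have h1' : ((n : ℤ) : ℝ) * s ≤ t := by exact_mod_cast h1
    have h2' : (t : ℝ) < (((n : ℤ) : ℝ) + 1) * s := by exact_mod_cast h2
    exact floor_div_eq hs' h1' h2'
  have hself : ∀ n : ℕ, ⌊(((n : ℝ≥0) * s : ℝ≥0) : ℝ) / s⌋ = n := fun n =>
    hfloor n _ le_rfl (mul_lt_mul_of_pos_right (by exact_mod_cast Nat.lt_succ_self n) hs)
  refine ⟨by simp, fun m n hmn => mul_lt_mul_of_pos_right (by exact_mod_cast hmn) hs,
    tendsto_natCast_atTop_atTop.atTop_mul_const hs, fun n t h1 h2 => ?_, fun n h => ?_⟩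
  · ext x y
    simp only [nnCond, rotWeight, rotEdge, hfloor n t h1 h2, hself n, Pi.zero_apply]
  · have h' := congrFun (congrFun h n) (n + 1)
    rw [nnCond_right, nnCond_right, rotWeight, rotWeight, rotEdge, rotEdge, hself, hself, sub_self,
      if_neg (show ((n : ℤ) - (n + 1 : ℕ)) % 3 ≠ 0 by omega), if_pos (by norm_num)] at h'
    linarith

lemma csrw_rotWeight (he : 0 < e) (hs : 0 < s) {Ω : Type*} [MeasurableSpace Ω] {P : Measure Ω}
    [IsProbabilityMeasure P] {Y : ℝ≥0 → Ω → ℤ} {x₀ : ℤ}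
    (hY : IsCSRW (nnCond (rotWeight e s) 0) P Y) (h0 : ∀ᵐ ω ∂P, Y 0 ω = x₀) :
    IsBallistic (fun t : ℝ≥0 => (t : ℝ)) P Y ∧ IsTransientCont P Y ∧
      ¬ OnDiagLowerBound (fun t : ℝ≥0 => (t : ℝ))
        (heatKernel (nnCond (rotWeight e s) 0) P Y) x₀ ∧
      ¬ OffDiagUpperBound (fun t : ℝ≥0 => (t : ℝ))
        (heatKernel (nnCond (rotWeight e s) 0) P Y) x₀ := by
  obtain ⟨J, H, hX⟩ := hY
  have hs' : (0 : ℝ) < s := hs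
  have hw := rotWeight_pos (s := s) he
  have hμ := measurable_stepProb_rotWeight (e := e) (s := s)
  have hsum : ∀ (t : ℝ≥0) (x : ℤ), stepProb (nnCond (rotWeight e s) 0) t x (x + 1) +
      stepProb (nnCond (rotWeight e s) 0) t x (x - 1) = 1 := fun t x => by
    have h := stepProb_nnCond_add (w := rotWeight e s) (ℓ := 0) t x hw fun _ _ => le_rfl
    rwa [stepProb_nnCond_self, Pi.zero_apply, Pi.zero_apply, zero_div, add_zero] at h
  set v := rotShift e s / s with hv
  have hv0 : 0 < v := div_pos (rotShift_pos he hs') hs'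
  obtain ⟨C, hC0, hC⟩ := exists_abs_rotHarmonic_sub_le he hs'
  refine csrw_conclusion (W := 2 * (1 + e)) (v := v) (fun t y => ?_) hX hv0.ne' ?_ ?_
  · have h1 := rotEdge_mem (s := s) he.le t y
    have h2 := rotEdge_mem (s := s) he.le t (y - 1)
    rw [vertexWeight_nnCond]
    change rotEdge e s t y + rotEdge e s t (y - 1) + 0 ∈ _
    exact ⟨by linarith [h1.1, h2.1], by linarith [h1.2, h2.2]⟩
  · -- the compensated number of jumps is itself a harmonic function
    have h := hX.expSmall_harmonic hw hμ h0 (F := fun n t _ => t - n) (K := 1) one_pos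
      (fun n x => by fun_prop) (fun n t h x y hh _ => by
        rw [abs_le]; push_cast; constructor <;> linarith) (fun n t x => by
        refine ((hasDerivAt_id (t : ℝ)).sub_const (n : ℝ)).hasDerivWithinAt.congr_deriv ?_
        push_cast
        linear_combination ((t : ℝ) - n - 1) * hsum t x)
    simpa using h
  · have h := hX.expSmall_harmonic hw hμ h0 (F := fun _ t x => rotHarmonic e s t x)
      (K := 2 * C + 1 + v) (by positivity) (fun n x => continuous_rotHarmonic he hs' x)
      (fun n t h x y hh hxy => by
        have h1 := abs_le.1 (hC (t + h) y)
        have h2 := abs_le.1 (hC t x)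
        have hxy' : |(y : ℝ) - x| ≤ 1 := by exact_mod_cast hxy.le
        have h3 := abs_le.1 hxy'
        have h4 : 0 ≤ v * h := mul_nonneg hv0.le hh
        have h5 : 0 ≤ C * h := mul_nonneg hC0 hh
        rw [abs_le]
        constructor <;> nlinarith) (fun n t x => by
        refine (hasDerivWithinAt_rotHarmonic he hs' t x).congr_deriv ?_
        rw [stepProb_nnCond_right, stepProb_nnCond_left, Pi.zero_apply, Pi.zero_apply, add_zero]
        rfl)
    refine h.of_abs_le (K := 2 * C) fun n => ae_of_all _ fun ω => ?_
    have h1 := abs_le.1 (hC (jumpTime H n ω) (J n ω))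
    have h2 := abs_le.1 (hC 0 x₀)
    have h3 := le_abs_self (rotHarmonic e s (jumpTime H n ω) (J n ω) - rotHarmonic e s 0 x₀)
    have h4 := neg_abs_le (rotHarmonic e s (jumpTime H n ω) (J n ω) - rotHarmonic e s 0 x₀)
    rw [abs_le]
    constructor <;> linarith

end RotatingWalk

/-! ### The two examples -/

theorem proposition1p3 :
    -- (i) discrete time
    (∀ γ ε : ℝ, γ < 1 → 0 < ε →
      ∃ μ : ℕ → ℤ → ℤ → ℝ,
        IsTimeDepConductance intLoopEdge μ ∧
        (∀ t x, μ t x (x + 1) ∈ Set.Icc (1 - ε) (1 + ε) ∧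
          μ t x (x - 1) ∈ Set.Icc (1 - ε) (1 + ε)) ∧
        IsLazy γ μ ∧
        ∀ x₀ : ℤ,
          (∃ (Ω : Type) (_ : MeasurableSpace Ω) (P : Measure Ω) (X : ℕ → Ω → ℤ),
            IsProbabilityMeasure P ∧ IsDiscreteWalk μ P X ∧ ∀ᵐ ω ∂P, X 0 ω = x₀) ∧
          ∀ (Ω : Type*) [MeasurableSpace Ω] (P : Measure Ω) [IsProbabilityMeasure P]
            (X : ℕ → Ω → ℤ), IsDiscreteWalk μ P X → (∀ᵐ ω ∂P, X 0 ω = x₀) →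
            IsBallistic (fun t : ℕ => (t : ℝ)) P X ∧
            IsTransientDiscrete P X ∧
            ¬ OnDiagLowerBound (fun t : ℕ => (t : ℝ)) (heatKernel μ P X) x₀ ∧
            ¬ OffDiagUpperBound (fun t : ℕ => (t : ℝ)) (heatKernel μ P X) x₀) ∧
    -- (ii) constant speed random walk
    (∀ ε c : ℝ, 0 < ε → 0 < c →
      ∃ (μ : ℝ≥0 → ℤ → ℤ → ℝ) (τ : ℕ → ℝ≥0),
        IsTimeDepConductance intEdge μ ∧
        (∀ t x, μ t x (x + 1) ∈ Set.Icc (1 - ε) (1 + ε) ∧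
          μ t x (x - 1) ∈ Set.Icc (1 - ε) (1 + ε)) ∧
        ChangesExactlyAt μ τ ∧
        Tendsto (fun n : ℕ => (τ n : ℝ) / n) atTop (𝓝 (1 / c)) ∧
        ∀ x₀ : ℤ,
          (∃ (Ω : Type) (_ : MeasurableSpace Ω) (P : Measure Ω) (Y : ℝ≥0 → Ω → ℤ),
            IsProbabilityMeasure P ∧ IsCSRW μ P Y ∧ ∀ᵐ ω ∂P, Y 0 ω = x₀) ∧
          ∀ (Ω : Type*) [MeasurableSpace Ω] (P : Measure Ω) [IsProbabilityMeasure P]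
            (Y : ℝ≥0 → Ω → ℤ), IsCSRW μ P Y → (∀ᵐ ω ∂P, Y 0 ω = x₀) →
            IsBallistic (fun t : ℝ≥0 => (t : ℝ)) P Y ∧
            IsTransientCont P Y ∧
            ¬ OnDiagLowerBound (fun t : ℝ≥0 => (t : ℝ)) (heatKernel μ P Y) x₀ ∧
            ¬ OffDiagUpperBound (fun t : ℝ≥0 => (t : ℝ)) (heatKernel μ P Y) x₀) := by
  refine ⟨fun γ ε hγ hε => ?_, fun ε c hε hc => ?_⟩
  · set e := min ε 1 with he
    have he0 : 0 < e := lt_min hε one_pos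
    have he1 : e ≤ 1 := min_le_right _ _
    have heε : e ≤ ε := min_le_left _ _
    -- the total weight of the two edges at a vertex is at most `3`
    set L := 3 / (1 - γ) with hL
    have hγ' : 0 < 1 - γ := by linarith
    have hL0 : 0 < L := by positivity
    have hedge := altEdge_mem he0.le
    have hloop := altLoop_mem hL0.le
    have hw : ∀ n x, 0 < altEdge e n x := fun n x => by linarith [(hedge n x).1]
    have hℓ : ∀ n x, 0 < altLoop L n x := fun n x => by linarith [(hloop n x).1]
    have hpair : ∀ (n : ℕ) (x : ℤ), altEdge e n x + altEdge e n (x - 1) ≤ 3 := fun n x => by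
      have h : ¬ (Even (x + n) ∧ Even (x - 1 + n)) := by
        rintro ⟨⟨i, hi⟩, ⟨j, hj⟩⟩; omega
      unfold altEdge
      split_ifs with h1 h2
      · exact absurd (And.intro h1 h2) h
      all_goals linarith
    refine ⟨nnCond (altEdge e) (altLoop L), ?_, fun t x => ?_, fun t x => ?_, fun x₀ => ⟨?_, ?_⟩⟩
    · have hK0 : 0 < L⁻¹ := inv_pos.2 hL0
      have hK : 2 ≤ 2 + 2 * L + L⁻¹ := by linarith
      have hKinv : (2 + 2 * L + L⁻¹)⁻¹ ≤ 1 := inv_le_one_of_one_le₀ (by linarith)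
      have hKinv' : (2 + 2 * L + L⁻¹)⁻¹ ≤ L := inv_le_of_inv_le₀ hL0 (by linarith)
      refine isTimeDepConductance_nnCond_loop (K := 2 + 2 * L + L⁻¹) (by linarith)
        (fun t x => ?_) fun t x => ?_
      · exact ⟨hKinv.trans (hedge t x).1, by linarith [(hedge t x).2]⟩
      · exact ⟨hKinv'.trans (hloop t x).1, by linarith [(hloop t x).2]⟩
    · rw [nnCond_right, nnCond_left]
      exact ⟨⟨by linarith [(hedge t x).1], by linarith [(hedge t x).2]⟩,
        ⟨by linarith [(hedge t (x - 1)).1], by linarith [(hedge t (x - 1)).2]⟩⟩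
    · rw [stepProb_nnCond_self, le_div_iff₀ (by linarith [hw t x, hw t (x - 1), hℓ t x])]
      have h1 : L * (1 - γ) = 3 := div_mul_cancel₀ _ hγ'.ne'
      have h2 := mul_le_mul_of_nonneg_right (hloop t x).1 hγ'.le
      by_cases hγ0 : 0 ≤ γ
      · have h3 := mul_le_mul_of_nonneg_left (hpair t x) hγ0
        nlinarith
      · nlinarith [hw t x, hw t (x - 1), hℓ t x]
    · exact ⟨_, _, noise, _, inferInstance, isDiscreteWalk_discreteWalk hw (fun n x => (hℓ n x).le)
        x₀, ae_of_all _ fun ω => rfl⟩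
    · intro Ω _ P _ X hX h0
      refine discrete_conclusion (W := 3 + 2 * L) (v := altSpeed e L) (fun t y => ?_) hX.measurable
        (ne_of_gt (by unfold altSpeed; positivity)) (hX.expSmall_altSpeed he0 hL0 h0)
      rw [vertexWeight_nnCond]
      exact ⟨by linarith [(hedge t y).1, hw t (y - 1), hℓ t y],
        by linarith [hpair t y, (hloop t y).2]⟩
  · set e := min ε 1 with he
    have he0 : 0 < e := lt_min hε one_pos
    have he1 : e ≤ 1 := min_le_right _ _
    have heε : e ≤ ε := min_le_left _ _
    set s : ℝ≥0 := (1 / c).toNNReal with hs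
    have hs0 : 0 < s := Real.toNNReal_pos.2 (by positivity)
    have hsc : (s : ℝ) = 1 / c := Real.coe_toNNReal _ (by positivity)
    have hedge : ∀ (t : ℝ≥0) x, rotWeight e s t x ∈ Set.Icc 1 (1 + e) := fun t x =>
      rotEdge_mem he0.le t x
    have hw := rotWeight_pos (s := s) he0
    refine ⟨nnCond (rotWeight e s) 0, fun n => n * s, ?_, fun t x => ?_,
      changesExactlyAt_rotWeight he0 hs0, ?_, fun x₀ => ⟨?_, ?_⟩⟩
    · refine isTimeDepConductance_nnCond_noLoop (K := 2) (by norm_num) fun t x => ?_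
      exact ⟨le_trans (by norm_num) (hedge t x).1, by linarith [(hedge t x).2]⟩
    · rw [nnCond_right, nnCond_left]
      exact ⟨⟨by linarith [(hedge t x).1], by linarith [(hedge t x).2]⟩,
        ⟨by linarith [(hedge t (x - 1)).1], by linarith [(hedge t (x - 1)).2]⟩⟩
    · refine tendsto_const_nhds.congr' ?_
      filter_upwards [eventually_gt_atTop 0] with n hn
      have : (n : ℝ) ≠ 0 := by exact_mod_cast hn.ne'
      push_cast
      rw [mul_div_cancel_left₀ _ this, hsc]
    · have hX := isCSRWWith_noise hw (fun _ _ => le_rfl)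
        (measurable_stepProb_rotWeight (e := e) (s := s)) x₀
      exact ⟨_, _, noise, _, inferInstance, ⟨_, _, hX⟩, hX.ae_zero⟩
    · intro Ω _ P _ Y hY h0
      exact csrw_rotWeight he0 hs0 hY h0
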